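/- Let $\alpha\in\mathbb R$. Let $\Gamma_0$ be the straight chain graph: an infinite sequence of rings of circumference $2\pi$ indexed by $j\in\mathbb Z$, where ring $j$ consists of two semicircular edges of length $\pi$, both joining the vertex $j$ to the vertex $j+1$ (so four edge ends meet at each vertex). Let $H_0$ be the operator in $L^2(\Gamma_0)$ acting as $\psi\mapsto-\psi''$ on each edge, whose domain consists of all $\psi\in L^2(\Gamma_0)$ that are of class $W^{2,2}$ on each edge, have $\psi''\in L^2(\Gamma_0)$, and satisfy the $\delta$-coupling of strength $\alpha$ at each vertex: the four boundary values of $\psi$ at the vertex coincide, and the sum of the four derivatives taken in the outgoing direction equals $\alpha$ times this common value. Let $\sigma(H_0)$ denote its spectrum. If $k\in\mathbb C$ satisfies $k^2\in\mathbb R\setminus\{0\}$ and $k\notin\mathbb N$, then $$k^2\in\sigma(H_0)\quad\Longleftrightarrow\quad \left|\cos k\pi+\frac{\alpha}{4}\cdot\frac{\sin k\pi}{k}\right|\le 1 .$$ -/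

import Mathlib

open MeasureTheory Set
open scoped ENNReal ContDiff

noncomputable section

/-! ### The Hilbert space of the chain graph -/

/-- Edges of the straight chain graph. The rings (of circumference `2π`) are numbered by `j : ℤ`;
ring `j` touches ring `j + 1` at the vertex `j + 1`. Each ring consists of two semicircles
(upper / lower, distinguished by the `Bool`), both joining vertex `j` to vertex `j + 1`. -/
abbrev ChainEdge : Type := ℤ × Bool

/-- Lebesgue (arc length) measure on one edge. Every edge is parametrized by `[0, π]`; for an
edge of ring `j` the point `0` is vertex `j` and the point `π` is vertex `j + 1`. -/
abbrev edgeMeasure : Measure ℝ := volume.restrict (Ioo 0 Real.pi)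

/-- `L²` of one edge. -/
abbrev EdgeL2 : Type := Lp ℂ 2 edgeMeasure

/-- The state space `L²(Γ₀)`: the Hilbert direct sum of the `L²` spaces of the edges. -/
abbrev ChainL2 : Type := lp (fun _ : ChainEdge => EdgeL2) 2

/-! ### Weak derivatives and the Sobolev space on an edge -/

/-- `g` is the weak derivative of `f` on the edge interval `(0, π)`. -/
def HasWeakDerivOnEdge (f g : ℝ → ℂ) : Prop :=
  LocallyIntegrableOn f (Ioo 0 Real.pi) ∧ LocallyIntegrableOn g (Ioo 0 Real.pi) ∧
    ∀ φ : ℝ → ℝ, ContDiff ℝ ∞ φ → HasCompactSupport φ → tsupport φ ⊆ Ioo 0 Real.pi →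
      ∫ x in Ioo 0 Real.pi, deriv φ x • f x = -∫ x in Ioo 0 Real.pi, φ x • g x

/-- The class `F ∈ L²(0, π)` belongs to `W^{2,2}(0, π)` with second weak derivative
`G ∈ L²(0, π)`, and `u`, `v` are the representatives of `F` and of its weak derivative that are
continuous on the closed interval `[0, π]`. (Such representatives exist for every element of
`W^{2,2}(0, π)` and are unique on `[0, π]`; they give the boundary values `u 0`, `u π`, `v 0`, `v π`
of the function and of its first derivative.) -/
structure IsW22OnEdge (F G : EdgeL2) (u v : ℝ → ℂ) : Prop where
  ae_eq : F =ᵐ[edgeMeasure] u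
  continuousOn : ContinuousOn u (Icc 0 Real.pi)
  continuousOn_deriv : ContinuousOn v (Icc 0 Real.pi)
  weakDeriv : HasWeakDerivOnEdge u v
  weakDeriv_deriv : HasWeakDerivOnEdge v G

/-! ### The δ-coupling -/

/-- The `δ`-coupling of strength `α` at the vertex `j`, for a function with edge components `u`
and edgewise first derivatives `v`. The four edge ends meeting at vertex `j` are the points `0` of
the two edges of ring `j` and the points `π` of the two edges of ring `j - 1`: the four values
agree, and the sum of the four derivatives taken in the direction out of the vertex equals `α`
times the common value. -/
def DeltaCoupling (α : ℝ) (u v : ChainEdge → ℝ → ℂ) (j : ℤ) : Prop :=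
  u (j, true) 0 = u (j, false) 0 ∧
  u (j - 1, true) Real.pi = u (j, false) 0 ∧
  u (j - 1, false) Real.pi = u (j, false) 0 ∧
  v (j, true) 0 + v (j, false) 0 - v (j - 1, true) Real.pi - v (j - 1, false) Real.pi
    = (α : ℂ) * u (j, false) 0

/-! ### Elementary closure properties -/

theorem HasWeakDerivOnEdge.congr_right {f g g' : ℝ → ℂ} (h : HasWeakDerivOnEdge f g)
    (hg : g =ᵐ[edgeMeasure] g') : HasWeakDerivOnEdge f g' := by
  obtain ⟨h1, h2, h3⟩ := h
  refine ⟨h1, ?_, fun φ a b c => ?_⟩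
  · intro x hx
    have h := h2 x hx
    obtain ⟨s, hs, hi⟩ := h
    refine ⟨s ∩ Ioo 0 Real.pi, Filter.inter_mem hs self_mem_nhdsWithin, ?_⟩
    refine (hi.mono_set inter_subset_left).congr_fun_ae ?_
    exact ae_restrict_of_ae_restrict_of_subset inter_subset_right hg
  · rw [h3 φ a b c]
    congr 1
    refine integral_congr_ae ?_
    filter_upwards [hg] with x hx
    rw [hx]

theorem integrable_smul_of_locallyIntegrableOn {f : ℝ → ℂ}
    (hf : LocallyIntegrableOn f (Ioo 0 Real.pi)) {φ : ℝ → ℝ} (h1 : Continuous φ)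
    (h2 : HasCompactSupport φ) (h3 : tsupport φ ⊆ Ioo 0 Real.pi) :
    Integrable (fun x => φ x • f x) edgeMeasure := by
  have hK : IntegrableOn f (tsupport φ) := hf.integrableOn_compact_subset h3 h2
  have hs : IntegrableOn (fun x => φ x • f x) (tsupport φ) :=
    hK.continuousOn_smul h1.continuousOn h2
  have : Integrable (fun x => φ x • f x) := by
    refine (integrableOn_iff_integrable_of_support_subset ?_).1 hs
    intro x hx
    apply subset_tsupport
    intro h0
    exact hx (by simp [h0])
  exact this.restrict

theorem HasWeakDerivOnEdge.add {f g f' g' : ℝ → ℂ} (h : HasWeakDerivOnEdge f g)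
    (h' : HasWeakDerivOnEdge f' g') : HasWeakDerivOnEdge (f + f') (g + g') := by
  refine ⟨h.1.add h'.1, h.2.1.add h'.2.1, fun φ a b c => ?_⟩
  have e1 := h.2.2 φ a b c
  have e2 := h'.2.2 φ a b c
  have cd : Continuous (deriv φ) := a.continuous_deriv (by simp)
  have c' : tsupport (deriv φ) ⊆ Ioo 0 Real.pi := tsupport_deriv_subset.trans c
  simp only [Pi.add_apply, smul_add]
  rw [integral_add (integrable_smul_of_locallyIntegrableOn h.1 cd b.deriv c')
      (integrable_smul_of_locallyIntegrableOn h'.1 cd b.deriv c'),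
    integral_add (integrable_smul_of_locallyIntegrableOn h.2.1 a.continuous b c)
      (integrable_smul_of_locallyIntegrableOn h'.2.1 a.continuous b c), e1, e2, neg_add]

theorem HasWeakDerivOnEdge.const_smul {f g : ℝ → ℂ} (c : ℂ) (h : HasWeakDerivOnEdge f g) :
    HasWeakDerivOnEdge (c • f) (c • g) := by
  refine ⟨h.1.smul c, h.2.1.smul c, fun φ a b d => ?_⟩
  have e1 := h.2.2 φ a b d
  simp only [Pi.smul_apply, smul_comm _ c]
  rw [integral_smul, integral_smul, e1, smul_neg]

theorem HasWeakDerivOnEdge.ae_eq_zero {f g : ℝ → ℂ} (h : HasWeakDerivOnEdge f g)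
    (hf : f =ᵐ[edgeMeasure] 0) : g =ᵐ[edgeMeasure] 0 := by
  have key := isOpen_Ioo.ae_eq_zero_of_integral_contDiff_smul_eq_zero h.2.1
    (fun φ a b c => by
      have e1 := h.2.2 φ a b c
      have e0 : ∫ x in Ioo 0 Real.pi, deriv φ x • f x = 0 := by
        refine integral_eq_zero_of_ae ?_
        filter_upwards [hf] with x hx
        simp [hx]
      rw [e0, eq_comm, neg_eq_zero] at e1
      rw [← e1, eq_comm]
      refine setIntegral_eq_integral_of_forall_compl_eq_zero fun x hx => ?_
      have : φ x = 0 := image_eq_zero_of_notMem_tsupport fun hx' => hx (c hx')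
      simp [this])
  exact (ae_restrict_iff' measurableSet_Ioo).2 key

theorem hasWeakDerivOnEdge_zero : HasWeakDerivOnEdge 0 0 :=
  ⟨locallyIntegrableOn_zero, locallyIntegrableOn_zero, fun φ _ _ _ => by simp⟩

/-! ### The Hamiltonian -/

/-- The graph of the Hamiltonian: the pairs `(ψ, -ψ'')` in `L²(Γ₀) × L²(Γ₀)` where `ψ` is of
class `W^{2,2}` on each edge and satisfies the `δ`-coupling of strength `α` at each vertex. -/
def chainGraph (α : ℝ) : Submodule ℂ (ChainL2 × ChainL2) where
  carrier := {p | ∃ u v : ChainEdge → ℝ → ℂ,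
    (∀ e, IsW22OnEdge (p.1 e) (-(p.2 e)) (u e) (v e)) ∧ ∀ j, DeltaCoupling α u v j}
  zero_mem' := by
    refine ⟨0, 0, fun e => ⟨?_, continuousOn_const, continuousOn_const, hasWeakDerivOnEdge_zero,
      ?_⟩, fun j => by simp [DeltaCoupling]⟩
    · simpa using Lp.coeFn_zero ℂ 2 edgeMeasure
    · refine hasWeakDerivOnEdge_zero.congr_right ?_
      simpa using (Lp.coeFn_zero ℂ 2 edgeMeasure).symm
  add_mem' := by
    rintro p q ⟨u, v, h, hd⟩ ⟨u', v', h', hd'⟩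
    refine ⟨u + u', v + v', fun e => ⟨?_, (h e).continuousOn.add (h' e).continuousOn,
      (h e).continuousOn_deriv.add (h' e).continuousOn_deriv, (h e).weakDeriv.add (h' e).weakDeriv,
      ?_⟩, fun j => ?_⟩
    · exact (Lp.coeFn_add (p.1 e) (q.1 e)).trans ((h e).ae_eq.add (h' e).ae_eq)
    · refine ((h e).weakDeriv_deriv.add (h' e).weakDeriv_deriv).congr_right ?_
      refine (Lp.coeFn_add (-(p.2 e)) (-(q.2 e))).symm.trans ?_
      rw [← neg_add]
      rfl
    · obtain ⟨a1, a2, a3, a4⟩ := hd j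
      obtain ⟨b1, b2, b3, b4⟩ := hd' j
      simp only [DeltaCoupling, Pi.add_apply]
      refine ⟨by rw [a1, b1], by rw [a2, b2], by rw [a3, b3], ?_⟩
      linear_combination a4 + b4
  smul_mem' := by
    rintro c p ⟨u, v, h, hd⟩
    refine ⟨c • u, c • v, fun e => ⟨?_, (h e).continuousOn.const_smul c,
      (h e).continuousOn_deriv.const_smul c, (h e).weakDeriv.const_smul c, ?_⟩, fun j => ?_⟩
    · exact (Lp.coeFn_smul c (p.1 e)).trans ((h e).ae_eq.const_smul c)
    · refine ((h e).weakDeriv_deriv.const_smul c).congr_right ?_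
      refine (Lp.coeFn_smul c (-(p.2 e))).symm.trans ?_
      rw [smul_neg]
      rfl
    · obtain ⟨a1, a2, a3, a4⟩ := hd j
      simp only [DeltaCoupling, Pi.smul_apply, smul_eq_mul]
      refine ⟨by rw [a1], by rw [a2], by rw [a3], ?_⟩
      linear_combination c * a4

/-- `-ψ''` is determined by `ψ`. -/
theorem chainGraph_single_valued (α : ℝ) (p : ChainL2 × ChainL2) (hp : p ∈ chainGraph α)
    (h0 : p.1 = 0) : p.2 = 0 := by
  obtain ⟨u, v, h, -⟩ := hp
  refine lp.ext (funext fun e => ?_)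
  have hz : u e =ᵐ[edgeMeasure] 0 := by
    refine (h e).ae_eq.symm.trans ?_
    rw [h0]
    exact Lp.coeFn_zero ℂ 2 edgeMeasure
  have h2 := (h e).weakDeriv_deriv.ae_eq_zero ((h e).weakDeriv.ae_eq_zero hz)
  have h3 : -(p.2 e) = 0 := (Lp.eq_zero_iff_ae_eq_zero).2 h2
  simpa using h3

/-- The Hamiltonian `H₀` of the straight chain: the unbounded operator `ψ ↦ -ψ''` in `L²(Γ₀)` whose
graph is `chainGraph α`. -/
def chainHamiltonian (α : ℝ) : ChainL2 →ₗ.[ℂ] ChainL2 :=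
  (chainGraph α).toLinearPMap

theorem chainHamiltonian_graph (α : ℝ) : (chainHamiltonian α).graph = chainGraph α :=
  Submodule.toLinearPMap_graph_eq _ (chainGraph_single_valued α)

/-! ### The spectrum of an unbounded operator -/

/-- The resolvent set of an unbounded operator `T`: the numbers `z` for which `T - z`, as a map
from the domain of `T` to the whole space, has an everywhere defined bounded two-sided inverse. -/
def unboundedResolventSet {H : Type*} [NormedAddCommGroup H] [NormedSpace ℂ H]
    (T : H →ₗ.[ℂ] H) : Set ℂ :=
  {z | ∃ R : H →L[ℂ] H,
    (∀ f : H, ∃ h : R f ∈ T.domain, T ⟨R f, h⟩ - z • R f = f) ∧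
    ∀ u : T.domain, R (T u - z • (u : H)) = u}

/-- The spectrum of an unbounded operator: the complement of its resolvent set. -/
def unboundedSpectrum {H : Type*} [NormedAddCommGroup H] [NormedSpace ℂ H]
    (T : H →ₗ.[ℂ] H) : Set ℂ :=
  (unboundedResolventSet T)ᶜ

end

noncomputable section

/-! ### Calculus of weak derivatives on an edge -/

/-! Write `c = cos kπ`, `s = sin kπ / k` and `D = c + (α/4) s`. The proof trades the differential
operator for a second-order difference operator on the vertex values.

If `s ≠ 0`, a solution of `-u'' = k² u + f` on an edge is fixed by its two end values. The outgoing
derivatives at the vertices are then explicit, and since `c² + k² s² = 1` the δ-coupling for vertex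
values `ψ` becomes `ψ (j+1) + ψ (j-1) - 2 D ψ j = source`, where the source depends boundedly on
`f`.

If `|D| > 1`, the translations have norm at most one, so a Neumann series inverts this difference
operator on `ℓ²(ℤ)` (`exists_discrete_resolvent`). Edgewise variation of constants lifts the inverse
to a bounded right inverse of `H₀ - k²` (`exists_chain_solution_operator`), and an eigenfunction
would have vertex values in the trivial kernel (`eq_zero_of_eigen`).

If `|D| ≤ 1`, then `D` is real because `k²` is, so `2 D = z + z⁻¹` with `|z| = 1`. The corresponding
Bloch solution, cut off smoothly to about `N` rings, has norm of order at least `√N`, while `H₀ -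
k²` maps it to something bounded in `N`; no bounded inverse exists (`mem_spectrum_of_multiplier`).

If `s = 0`, then `|D| = |c| = 1`, and `k²` is an eigenvalue with an eigenfunction living on a single
ring (`mem_spectrum_of_sinSol_eq_zero`). -/

theorem intervalIntegral_eq_integral_indicator_Iic (g : ℝ → ℂ) {x : ℝ} (hx : x ∈ Ioo 0 Real.pi) :
    ∫ t in (0 : ℝ)..x, g t = ∫ t, (Iic x).indicator g t ∂edgeMeasure := by
  rw [integral_indicator measurableSet_Iic, Measure.restrict_restrict measurableSet_Iic,
    intervalIntegral.integral_of_le hx.1.le]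
  congr 2
  ext t
  simp only [mem_Ioc, mem_inter_iff, mem_Iic, mem_Ioo]
  exact ⟨fun h => ⟨h.2, h.1, h.2.trans_lt hx.2⟩, fun h => ⟨h.2.1, h.1⟩⟩

theorem Continuous.integrable_edge {f : ℝ → ℂ} (hf : Continuous f) : Integrable f edgeMeasure :=
  (hf.continuousOn.integrableOn_Icc (a := 0) (b := Real.pi)).mono_set Ioo_subset_Icc_self

theorem ContinuousOn.integrable_edge {f : ℝ → ℂ} (hf : ContinuousOn f (Icc 0 Real.pi)) :
    Integrable f edgeMeasure :=
  (hf.integrableOn_Icc).mono_set Ioo_subset_Icc_self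

/-- Integration by parts of a `C¹` function vanishing at `π` against a primitive. -/
theorem integral_deriv_mul_primitive {ψ ψ' g : ℝ → ℂ} (hψ : ∀ x, HasDerivAt ψ (ψ' x) x)
    (hc : Continuous ψ') (hpi : ψ Real.pi = 0) (hg : Integrable g edgeMeasure) :
    ∫ x in Ioo 0 Real.pi, ψ' x * ∫ t in (0 : ℝ)..x, g t = -∫ x in Ioo 0 Real.pi, ψ x * g x := by
  have e1 : ∫ x in Ioo 0 Real.pi, ψ' x * ∫ t in (0 : ℝ)..x, g t =
      ∫ x, ∫ t, ψ' x * (Iic x).indicator g t ∂edgeMeasure ∂edgeMeasure := by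
    refine setIntegral_congr_fun measurableSet_Ioo fun x hx => ?_
    simp only [intervalIntegral_eq_integral_indicator_Iic g hx]
    rw [integral_const_mul]
  have hint : Integrable (fun z : ℝ × ℝ => ψ' z.1 * (Iic z.1).indicator g z.2)
      (edgeMeasure.prod edgeMeasure) := by
    have h1 : Integrable (fun z : ℝ × ℝ => ψ' z.1 * g z.2) (edgeMeasure.prod edgeMeasure) :=
      hc.integrable_edge.mul_prod hg
    have h2 : MeasurableSet {z : ℝ × ℝ | z.2 ≤ z.1} := measurableSet_le measurable_snd measurable_fst
    refine (h1.indicator h2).congr (Filter.Eventually.of_forall fun z => ?_)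
    by_cases h : z.2 ≤ z.1 <;> simp [indicator, h]
  -- Fubini on the triangle `t ≤ x`: the inner integral of `ψ'` over `[t, π)` is `-ψ t`, because `ψ
  -- π = 0`.
  rw [e1, integral_integral_swap hint, ← integral_neg]
  refine setIntegral_congr_fun measurableSet_Ioo fun t ht => ?_
  have e2 : ∀ x, ψ' x * (Iic x).indicator g t = (Ici t).indicator ψ' x * g t := by
    intro x
    by_cases h : t ≤ x <;> simp [indicator, h]
  simp only [e2]
  rw [integral_mul_const, integral_indicator measurableSet_Ici,
    Measure.restrict_restrict measurableSet_Ici]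
  have e3 : Ici t ∩ Ioo 0 Real.pi = Ico t Real.pi := by
    ext x
    simp only [mem_inter_iff, mem_Ici, mem_Ioo, mem_Ico]
    exact ⟨fun h => ⟨h.1, h.2.2⟩, fun h => ⟨h.1, ht.1.trans_le h.1, h.2⟩⟩
  rw [e3, integral_Ico_eq_integral_Ioo, ← integral_Ioc_eq_integral_Ioo,
    ← intervalIntegral.integral_of_le ht.2.le,
    intervalIntegral.integral_eq_sub_of_hasDerivAt (fun x _ => hψ x) (hc.intervalIntegrable _ _),
    hpi]
  ring

theorem continuousOn_primitive_edge {g : ℝ → ℂ} (hg : Integrable g edgeMeasure) :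
    ContinuousOn (fun x => ∫ t in (0 : ℝ)..x, g t) (Icc 0 Real.pi) :=
  intervalIntegral.continuousOn_primitive_interval'
    ((intervalIntegrable_iff_integrableOn_Ioo_of_le Real.pi_pos.le).2 hg)
    (by simp [Real.pi_pos.le]) |>.mono (by rw [uIcc_of_le Real.pi_pos.le])

theorem ContinuousOn.locallyIntegrableOn_edge {f : ℝ → ℂ} (hf : ContinuousOn f (Icc 0 Real.pi)) :
    LocallyIntegrableOn f (Ioo 0 Real.pi) :=
  IntegrableOn.locallyIntegrableOn hf.integrable_edge

/-- Leibniz rule for the product of a `C¹` function and a primitive of an integrable function. -/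
theorem hasWeakDerivOnEdge_mul_primitive {c c' g : ℝ → ℂ} (hc : ∀ x, HasDerivAt c (c' x) x)
    (hc' : Continuous c') (hg : Integrable g edgeMeasure) (C : ℂ) :
    HasWeakDerivOnEdge (fun x => c x * (C + ∫ t in (0 : ℝ)..x, g t))
      (fun x => c' x * (C + ∫ t in (0 : ℝ)..x, g t) + c x * g x) := by
  have hcc : Continuous c := continuous_iff_continuousAt.2 fun x => (hc x).continuousAt
  have hF : ContinuousOn (fun x => C + ∫ t in (0 : ℝ)..x, g t) (Icc 0 Real.pi) :=
    continuousOn_const.add (continuousOn_primitive_edge hg)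
  have hcg : Integrable (fun x => c x * g x) edgeMeasure := by
    have h2 : IntegrableOn g (Icc 0 Real.pi) := by
      rw [integrableOn_Icc_iff_integrableOn_Ioo]; exact hg
    exact (h2.continuousOn_mul hcc.continuousOn isCompact_Icc).mono_set Ioo_subset_Icc_self
  have hcF := (hcc.continuousOn.mul hF)
  have hc'F := (hc'.continuousOn.mul hF)
  refine ⟨hcF.locallyIntegrableOn_edge, IntegrableOn.locallyIntegrableOn
    (hc'F.integrable_edge.add hcg), fun φ a b d => ?_⟩
  have hφ : ∀ x, HasDerivAt φ (deriv φ x) x := fun x =>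
    (a.differentiable (by simp) x).hasDerivAt
  have hφc : Continuous (deriv φ) := a.continuous_deriv (by simp)
  have hz : ∀ x, x ∉ Ioo 0 Real.pi → φ x = 0 := fun x hx =>
    image_eq_zero_of_notMem_tsupport fun h => hx (d h)
  -- The smooth factor is absorbed into the test function. The constant `C` contributes `C * ∫ ψ' =
  -- 0`, as `ψ` vanishes at both ends.
  set ψ : ℝ → ℂ := fun x => φ x * c x
  set ψ' : ℝ → ℂ := fun x => deriv φ x * c x + φ x * c' x
  have hψ : ∀ x, HasDerivAt ψ (ψ' x) x := fun x => (hφ x).ofReal_comp.mul (hc x)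
  have hφ0 : Continuous φ := a.continuous
  have hψ' : Continuous ψ' := by fun_prop
  have key := integral_deriv_mul_primitive hψ hψ' (by simp [ψ, hz]) hg
  have k0 : ∫ x in Ioo 0 Real.pi, ψ' x = 0 := by
    rw [← integral_Ioc_eq_integral_Ioo, ← intervalIntegral.integral_of_le Real.pi_pos.le,
      intervalIntegral.integral_eq_sub_of_hasDerivAt (fun x _ => hψ x)
        (hψ'.intervalIntegrable _ _)]
    simp [ψ, hz]
  have i1 : Integrable (fun x => ψ' x * ∫ t in (0 : ℝ)..x, g t) edgeMeasure :=
    (hψ'.continuousOn.mul (continuousOn_primitive_edge hg)).integrable_edge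
  have i2 : Integrable (fun x => C * ψ' x) edgeMeasure := hψ'.integrable_edge.const_mul C
  have i3 : Integrable (fun x => (φ x : ℂ) * (c' x * (C + ∫ t in (0 : ℝ)..x, g t))) edgeMeasure :=
    ((Complex.continuous_ofReal.comp hφ0).continuousOn.mul hc'F).integrable_edge
  have i4 : Integrable (fun x => (φ x : ℂ) * (c x * g x)) edgeMeasure := by
    have h2 : IntegrableOn g (Icc 0 Real.pi) := by
      rw [integrableOn_Icc_iff_integrableOn_Ioo]; exact hg
    have := (h2.continuousOn_mul (g := ψ)
      (by fun_prop : Continuous ψ).continuousOn isCompact_Icc).mono_set Ioo_subset_Icc_self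
    refine this.congr (Filter.Eventually.of_forall fun x => ?_)
    simp [ψ]; ring
  calc ∫ x in Ioo 0 Real.pi, deriv φ x • (c x * (C + ∫ t in (0 : ℝ)..x, g t))
      = ∫ x in Ioo 0 Real.pi, ((ψ' x * ∫ t in (0 : ℝ)..x, g t) + C * ψ' x)
          - (φ x : ℂ) * (c' x * (C + ∫ t in (0 : ℝ)..x, g t)) := by
        refine setIntegral_congr_fun measurableSet_Ioo fun x hx => ?_
        simp only [ψ', Complex.real_smul]; ring
    _ = -(∫ x in Ioo 0 Real.pi, ψ x * g x) -
          ∫ x in Ioo 0 Real.pi, (φ x : ℂ) * (c' x * (C + ∫ t in (0 : ℝ)..x, g t)) := by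
        have i12 : Integrable (fun x => (ψ' x * ∫ t in (0 : ℝ)..x, g t) + C * ψ' x) edgeMeasure :=
          i1.add i2
        rw [integral_sub i12 i3, integral_add i1 i2, key, integral_const_mul, k0]
        ring
    _ = _ := by
        simp only [Complex.real_smul, mul_add (φ _ : ℂ)]
        rw [integral_add (by simpa only [mul_add] using i3) i4]
        simp only [ψ, mul_assoc]
        ring

theorem hasWeakDerivOnEdge_of_hasDerivAt {c c' : ℝ → ℂ} (hc : ∀ x, HasDerivAt c (c' x) x)
    (hc' : Continuous c') : HasWeakDerivOnEdge c c' := by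
  simpa using hasWeakDerivOnEdge_mul_primitive hc hc' (integrable_zero ℝ ℂ edgeMeasure) 1

theorem isW22OnEdge_of_hasDerivAt {u v w : ℝ → ℂ} (hu : ∀ x, HasDerivAt u (v x) x)
    (hv : ∀ x, HasDerivAt v (w x) x) (hw : Continuous w) {F G : EdgeL2}
    (hF : F =ᵐ[edgeMeasure] u) (hG : G =ᵐ[edgeMeasure] w) : IsW22OnEdge F G u v := by
  have hvc : Continuous v := continuous_iff_continuousAt.2 fun x => (hv x).continuousAt
  have huc : Continuous u := continuous_iff_continuousAt.2 fun x => (hu x).continuousAt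
  exact ⟨hF, huc.continuousOn, hvc.continuousOn, hasWeakDerivOnEdge_of_hasDerivAt hu hvc,
    (hasWeakDerivOnEdge_of_hasDerivAt hv hw).congr_right hG.symm⟩

/-! ### The lemma of du Bois-Reymond -/

theorem exists_edge_bump : ∃ ρ : ℝ → ℝ, ContDiff ℝ ∞ ρ ∧ HasCompactSupport ρ ∧
    tsupport ρ ⊆ Ioo 0 Real.pi ∧ ∫ x in (0 : ℝ)..Real.pi, ρ x = 1 := by
  have hp := Real.pi_pos
  let b : ContDiffBump (Real.pi / 2) := ⟨Real.pi / 8, Real.pi / 4, by positivity, by linarith⟩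
  have hs : tsupport (b.normed volume) ⊆ Ioo 0 Real.pi := by
    rw [b.tsupport_normed_eq, Real.closedBall_eq_Icc]
    intro x hx
    simp only [mem_Icc] at hx
    change Real.pi / 2 - Real.pi / 4 ≤ x ∧ x ≤ Real.pi / 2 + Real.pi / 4 at hx
    constructor <;> linarith [hx.1, hx.2]
  refine ⟨b.normed volume, b.contDiff_normed, b.hasCompactSupport_normed, hs, ?_⟩
  rw [intervalIntegral.integral_of_le hp.le, setIntegral_eq_integral_of_forall_compl_eq_zero,
    b.integral_normed]
  intro x hx
  exact image_eq_zero_of_notMem_tsupport fun h => hx (Ioo_subset_Ioc_self (hs h))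

/-- A test function with zero mean is the derivative of a test function. -/
theorem exists_test_primitive {χ : ℝ → ℝ} (h1 : ContDiff ℝ ∞ χ) (h2 : HasCompactSupport χ)
    (h3 : tsupport χ ⊆ Ioo 0 Real.pi) (h4 : ∫ x in (0 : ℝ)..Real.pi, χ x = 0) :
    ∃ φ : ℝ → ℝ, ContDiff ℝ ∞ φ ∧ HasCompactSupport φ ∧ tsupport φ ⊆ Ioo 0 Real.pi ∧
      deriv φ = χ := by
  obtain ⟨a, b, ha, hb, hab⟩ : ∃ a b : ℝ, 0 < a ∧ b < Real.pi ∧ tsupport χ ⊆ Icc a b := by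
    rcases (tsupport χ).eq_empty_or_nonempty with h | h
    -- An empty support is enclosed in the empty interval `Icc 1 0`.
    · exact ⟨1, 0, one_pos, Real.pi_pos, by simp [h]⟩
    · obtain ⟨a, ha⟩ := h2.isCompact.exists_isLeast h
      obtain ⟨b, hb⟩ := h2.isCompact.exists_isGreatest h
      exact ⟨a, b, (h3 ha.1).1, (h3 hb.1).2, fun x hx => ⟨ha.2 hx, hb.2 hx⟩⟩
  have hz : ∀ x, x ∉ Icc a b → χ x = 0 := fun x hx =>
    image_eq_zero_of_notMem_tsupport fun h => hx (hab h)
  have hd : ∀ x, HasDerivAt (fun x => ∫ t in (0 : ℝ)..x, χ t) (χ x) x := fun x =>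
    intervalIntegral.integral_hasDerivAt_right (h1.continuous.intervalIntegrable _ _)
      (h1.continuous.stronglyMeasurableAtFilter _ _) h1.continuous.continuousAt
  have hd' : deriv (fun x => ∫ t in (0 : ℝ)..x, χ t) = χ := funext fun x => (hd x).deriv
  have hs : tsupport (fun x => ∫ t in (0 : ℝ)..x, χ t) ⊆ Icc a b := by
    refine closure_minimal (fun x hx => ?_) isClosed_Icc
    by_contra hx'
    refine hx ?_
    rcases lt_or_ge x a with h | h
    · refine intervalIntegral.integral_zero_ae (Filter.Eventually.of_forall fun t ht => hz t ?_)
      intro ht'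
      have := ht'.1
      rcases le_max_iff.1 ht.2 with h' | h' <;> linarith
    · have hbx : b < x := by
        by_contra hh
        exact hx' ⟨h, not_lt.1 hh⟩
      change ∫ t in (0 : ℝ)..x, χ t = 0
      -- Beyond `b` the primitive is the full integral, zero by `h4`, plus an integral over a
      -- segment where `χ` vanishes.
      rw [← intervalIntegral.integral_add_adjacent_intervals
        (h1.continuous.intervalIntegrable 0 Real.pi) (h1.continuous.intervalIntegrable Real.pi x),
        h4, zero_add]
      refine intervalIntegral.integral_zero_ae (Filter.Eventually.of_forall fun t ht => hz t ?_)
      intro ht'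
      have := ht'.2
      rcases min_lt_iff.1 ht.1 with h' | h' <;> linarith
  refine ⟨_, contDiff_infty_iff_deriv.2 ⟨fun x => (hd x).differentiableAt, by rwa [hd']⟩,
    isCompact_Icc.of_isClosed_subset (isClosed_tsupport _) hs,
    hs.trans fun x hx => ⟨ha.trans_le hx.1, hx.2.trans_lt hb⟩, hd'⟩

/-- A continuous function with continuous weak derivative is its primitive. -/
theorem HasWeakDerivOnEdge.eq_add_integral {f g : ℝ → ℂ} (h : HasWeakDerivOnEdge f g)
    (hf : ContinuousOn f (Icc 0 Real.pi)) (hg : ContinuousOn g (Icc 0 Real.pi)) :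
    ∀ x ∈ Icc 0 Real.pi, f x = f 0 + ∫ t in (0 : ℝ)..x, g t := by
  obtain ⟨ρ, hρ1, hρ2, hρ3, hρ4⟩ := exists_edge_bump
  have hgi := hg.integrable_edge
  have hF := hasWeakDerivOnEdge_mul_primitive (c := fun _ => 1) (fun x => hasDerivAt_const x (1 : ℂ))
    continuous_const hgi 0
  simp only [one_mul, zero_mul, zero_add] at hF
  have hh := h.add (hF.const_smul (-1))
  -- `q` has weak derivative zero; it is shown to equal its `ρ`-weighted mean `c`.
  set q : ℝ → ℂ := f + (-1 : ℂ) • fun x => ∫ t in (0 : ℝ)..x, g t with hq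
  have hqc : ContinuousOn q (Icc 0 Real.pi) :=
    hf.add ((continuousOn_primitive_edge hgi).const_smul (-1 : ℂ))
  have hg0 : (g + (-1 : ℂ) • g) = 0 := by ext; simp
  rw [hg0] at hh
  set c : ℂ := ∫ x in Ioo 0 Real.pi, ρ x • q x with hc
  have hql := hqc.locallyIntegrableOn_edge
  have hqz : LocallyIntegrableOn (fun x => q x - c) (Ioo 0 Real.pi) :=
    (hqc.sub continuousOn_const).locallyIntegrableOn_edge
  have hae : ∀ᵐ x, x ∈ Ioo 0 Real.pi → q x - c = 0 := by
    refine isOpen_Ioo.ae_eq_zero_of_integral_contDiff_smul_eq_zero hqz fun χ h1 h2 h3 => ?_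
    set m : ℝ := ∫ x in (0 : ℝ)..Real.pi, χ x with hm
    -- Since `ρ` has integral one, `χ - m ρ` has mean zero and is the derivative of a test function,
    -- so `∫ χ (q - c) = ∫ (χ - m ρ) q = 0`.
    have hs : tsupport (χ - fun x => m * ρ x) ⊆ Ioo 0 Real.pi :=
      (tsupport_sub _ _).trans (union_subset h3 ((tsupport_mul_subset_right).trans hρ3))
    obtain ⟨φ, p1, p2, p3, p4⟩ := exists_test_primitive (χ := χ - fun x => m * ρ x)
      (h1.sub (contDiff_const.mul hρ1)) (h2.sub (hρ2.mul_left)) hs (by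
        simp only [Pi.sub_apply]
        have i := (hρ1.continuous.const_mul m).intervalIntegrable (μ := volume) 0 Real.pi
        rw [intervalIntegral.integral_sub (h1.continuous.intervalIntegrable _ _) i,
          intervalIntegral.integral_const_mul, hρ4, ← hm]
        ring)
    have key := hh.2.2 φ p1 p2 p3
    rw [p4] at key
    have i1 := integrable_smul_of_locallyIntegrableOn hql h1.continuous h2 h3
    have i2 := integrable_smul_of_locallyIntegrableOn hql hρ1.continuous hρ2 hρ3
    have i3 : Integrable (fun x => (χ x : ℂ)) edgeMeasure :=
      (Complex.continuous_ofReal.comp h1.continuous).integrable_edge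
    have e1 : ∫ x in Ioo 0 Real.pi, (χ - fun x => m * ρ x) x • q x =
        (∫ x in Ioo 0 Real.pi, χ x • q x) - m * c := by
      rw [hc, ← integral_const_mul, ← integral_sub i1 (i2.const_mul _)]
      refine integral_congr_ae (Filter.Eventually.of_forall fun x => ?_)
      simp [sub_mul, mul_assoc]
    have e2 : ∫ x in Ioo 0 Real.pi, (χ x : ℂ) = m := by
      rw [hm, ← intervalIntegral.integral_ofReal, intervalIntegral.integral_of_le Real.pi_pos.le,
        integral_Ioc_eq_integral_Ioo]
    rw [← setIntegral_eq_integral_of_forall_compl_eq_zero (s := Ioo 0 Real.pi)]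
    · calc ∫ x in Ioo 0 Real.pi, χ x • (q x - c)
          = ∫ x in Ioo 0 Real.pi, χ x • q x - χ x * c := by
            refine integral_congr_ae (Filter.Eventually.of_forall fun x => ?_)
            simp [mul_sub]
        _ = (∫ x in Ioo 0 Real.pi, χ x • q x) - m * c := by
            rw [integral_sub i1 (i3.mul_const c), integral_mul_const, e2]
        _ = 0 := by rw [← e1, key]; simp
    · intro x hx
      have : χ x = 0 := image_eq_zero_of_notMem_tsupport fun h => hx (h3 h)
      simp [this]
  have heq : EqOn q (fun _ => c) (Icc 0 Real.pi) := by
    refine Measure.eqOn_Icc_of_ae_eq volume Real.pi_pos.ne ?_ hqc continuousOn_const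
    rw [restrict_Ioo_eq_restrict_Icc.symm]
    filter_upwards [(ae_restrict_iff' measurableSet_Ioo).2 hae] with x hx
    exact sub_eq_zero.1 hx
  intro x hx
  have a1 := heq hx
  have a2 := heq (left_mem_Icc.2 Real.pi_pos.le)
  simp only [hq, Pi.add_apply, Pi.smul_apply, intervalIntegral.integral_same, smul_eq_mul,
    mul_zero, add_zero] at a1 a2
  rw [a2, ← a1]
  ring

/-! ### Operators between `ℓ²` spaces acting through a change of index -/

theorem lp_two_summable {κ E : Type*} [NormedAddCommGroup E] (x : lp (fun _ : κ => E) 2) : Summable fun i => ‖x i‖ ^ 2 := by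
  have := (lp.memℓp x).summable (by simp)
  simpa using this

theorem lp_two_norm_sq {κ E : Type*} [NormedAddCommGroup E] (x : lp (fun _ : κ => E) 2) : ‖x‖ ^ 2 = ∑' i, ‖x i‖ ^ 2 := by
  have := lp.norm_rpow_eq_tsum (p := 2) (by simp) x
  simpa using this

theorem memℓp_two_of_summable {κ E : Type*} [NormedAddCommGroup E] {f : κ → E} (h : Summable fun i => ‖f i‖ ^ 2) : Memℓp f 2 :=
  memℓp_gen (by simpa using h)

section Apply

variable {κ E : Type*} [NormedAddCommGroup E] (x y : lp (fun _ : κ => E) 2) (i : κ)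

theorem lp_two_add_apply : (x + y) i = x i + y i := rfl

theorem lp_two_sub_apply : (x - y) i = x i - y i := rfl

theorem lp_two_neg_apply : (-x) i = -x i := rfl

theorem lp_two_smul_apply [NormedSpace ℂ E] (c : ℂ) : (c • x) i = c • x i := rfl

end Apply

section Pull

variable {ι κ E F : Type*} [NormedAddCommGroup E] [NormedSpace ℂ E] [NormedAddCommGroup F]
  [NormedSpace ℂ F]

/-- `τ` pulls summable families back to summable families, with control of the sum. -/
def SummablePull (τ : ι → κ) (C : ℝ) : Prop :=
  ∀ h : κ → ℝ, (∀ i, 0 ≤ h i) → Summable h → Summable (h ∘ τ) ∧ ∑' i, h (τ i) ≤ C * ∑' i, h i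

theorem SummablePull.of_injective {τ : ι → κ} (hτ : Function.Injective τ) : SummablePull τ 1 :=
  fun h h0 hs => ⟨hs.comp_injective hτ, by
    rw [one_mul]; exact tsum_comp_le_tsum_of_inj hs h0 hτ⟩

theorem SummablePull.comp {μ : Type*} {τ : ι → κ} {σ : κ → μ} {C D : ℝ} (hC : 0 ≤ C)
    (hτ : SummablePull τ C) (hσ : SummablePull σ D) : SummablePull (σ ∘ τ) (C * D) := by
  intro h h0 hs
  obtain ⟨a, b⟩ := hσ h h0 hs
  obtain ⟨a', b'⟩ := hτ _ (fun i => h0 (σ i)) a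
  refine ⟨a', b'.trans ?_⟩
  rw [mul_assoc]
  exact mul_le_mul_of_nonneg_left b hC

/-- Each ring has two semicircles, so every term is counted twice. -/
theorem SummablePull.fst : SummablePull (Prod.fst : κ × Bool → κ) 2 := by
  intro h h0 hs
  have hb : ∀ j : κ, HasSum (fun b : Bool => h ((j, b) : κ × Bool).1) (2 * h j) := fun j => by
    have := hasSum_fintype fun b : Bool => h ((j, b) : κ × Bool).1
    simpa [two_mul] using this
  have hsum : Summable (fun e : κ × Bool => h e.1) := by
    refine (summable_prod_of_nonneg fun e => h0 e.1).2 ⟨fun j => (hb j).summable, ?_⟩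
    simp only [(hb _).tsum_eq]
    exact hs.mul_left 2
  refine ⟨hsum, ?_⟩
  have := (hsum.hasSum.prod_fiberwise hb).unique (hs.hasSum.mul_left 2)
  exact this.le

theorem pull_bound {τ : ι → κ} {C : ℝ} (hτ : SummablePull τ C) (L : E →L[ℂ] F)
    (x : lp (fun _ : κ => E) 2) : Summable (fun i => ‖L (x (τ i))‖ ^ 2) ∧
      ∑' i, ‖L (x (τ i))‖ ^ 2 ≤ ‖L‖ ^ 2 * (C * ‖x‖ ^ 2) := by
  obtain ⟨a, b⟩ := hτ (fun i => ‖x i‖ ^ 2) (fun i => by positivity) (lp_two_summable x)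
  have hle : ∀ i, ‖L (x (τ i))‖ ^ 2 ≤ ‖L‖ ^ 2 * ‖x (τ i)‖ ^ 2 := fun i => by
    rw [← mul_pow]; gcongr; exact L.le_opNorm _
  have hs : Summable (fun i => ‖L (x (τ i))‖ ^ 2) :=
    Summable.of_nonneg_of_le (fun i => by positivity) hle (a.mul_left _)
  refine ⟨hs, (hs.tsum_le_tsum hle (a.mul_left _)).trans ?_⟩
  rw [tsum_mul_left, lp_two_norm_sq]
  gcongr

/-- The operator `x ↦ (L (x (τ i)))ᵢ` between `ℓ²` spaces. -/
def lpPull {τ : ι → κ} {C : ℝ} (hτ : SummablePull τ C) (L : E →L[ℂ] F) :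
    lp (fun _ : κ => E) 2 →L[ℂ] lp (fun _ : ι => F) 2 :=
  LinearMap.mkContinuous
    { toFun := fun x => ⟨fun i => L (x (τ i)), memℓp_two_of_summable (pull_bound hτ L x).1⟩
      map_add' := fun x y => lp.ext <| funext fun i => L.map_add _ _
      map_smul' := fun c x => lp.ext <| funext fun i => L.map_smul _ _ }
    -- `SummablePull` does not demand `0 ≤ C`, hence the absolute value.
    (‖L‖ * √|C|) fun x => by
      refine abs_le_of_sq_le_sq' ?_ (by positivity) |>.2
      rw [lp_two_norm_sq, mul_pow, mul_pow, Real.sq_sqrt (abs_nonneg _), mul_assoc]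
      refine (pull_bound hτ L x).2.trans ?_
      gcongr
      exact le_abs_self C

@[simp] theorem lpPull_apply {τ : ι → κ} {C : ℝ} (hτ : SummablePull τ C) (L : E →L[ℂ] F)
    (x : lp (fun _ : κ => E) 2) (i : ι) : lpPull hτ L x i = L (x (τ i)) := rfl

theorem norm_lpPull_le_one {τ : ι → κ} (hτ : SummablePull τ 1) :
    ‖lpPull hτ (ContinuousLinearMap.id ℂ E)‖ ≤ 1 := by
  refine ContinuousLinearMap.opNorm_le_bound _ zero_le_one fun x => ?_
  have := (pull_bound hτ (ContinuousLinearMap.id ℂ E) x).2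
  refine abs_le_of_sq_le_sq' ?_ (by positivity) |>.2
  rw [lp_two_norm_sq, one_mul]
  simp only [lpPull_apply, ContinuousLinearMap.coe_id', id_eq] at this ⊢
  have := (hτ (fun i => ‖x i‖ ^ 2) (fun i => by positivity) (lp_two_summable x)).2
  rwa [one_mul, ← lp_two_norm_sq] at this

end Pull

/-! ### The discrete Laplacian on `ℤ` -/

/-- The Hilbert space `ℓ²(ℤ)`. -/
abbrev EllTwo : Type := lp (fun _ : ℤ => ℂ) 2

/-- The translation operator `(x_j) ↦ (x_{j+m})` in `ℓ²(ℤ)`. -/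
def shift (m : ℤ) : EllTwo →L[ℂ] EllTwo :=
  lpPull (SummablePull.of_injective (add_left_injective m)) (ContinuousLinearMap.id ℂ ℂ)

@[simp] theorem shift_apply (m : ℤ) (x : EllTwo) (j : ℤ) : shift m x j = x (j + m) := rfl

theorem norm_shift_le (m : ℤ) : ‖shift m‖ ≤ 1 := norm_lpPull_le_one _

/-- For `|D| > 1` the operator `S + S⁻¹ - 2 D` in `ℓ²(ℤ)` has a bounded inverse. -/
theorem exists_discrete_resolvent {D : ℂ} (hD : 1 < ‖D‖) :
    ∃ K : EllTwo →L[ℂ] EllTwo,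
      (∀ g j, K g (j + 1) + K g (j - 1) - 2 * D * K g j = g j) ∧
      ∀ x : EllTwo, (∀ j, x (j + 1) + x (j - 1) - 2 * D * x j = 0) → x = 0 := by
  have hD0 : D ≠ 0 := by rintro rfl; simp at hD; linarith
  -- With this `A`, `S + S⁻¹ - 2 D = -2 D (1 - A)` and `‖A‖ ≤ 1 / |D| < 1`.
  set A : EllTwo →L[ℂ] EllTwo := (2 * D)⁻¹ • (shift 1 + shift (-1)) with hA
  have hAn : ‖A‖ < 1 := by
    have h2 : ‖shift 1 + shift (-1)‖ ≤ 2 :=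
      (norm_add_le _ _).trans (by linarith [norm_shift_le 1, norm_shift_le (-1)])
    rw [hA, norm_smul, norm_inv, norm_mul, Complex.norm_ofNat, inv_mul_lt_iff₀ (by positivity)]
    linarith
  have hu : IsUnit (1 - A) := isUnit_one_sub_of_norm_lt_one hAn
  obtain ⟨B, hB⟩ := hu
  have app : ∀ (x : EllTwo) j, x (j + 1) + x (j - 1) - 2 * D * x j =
      -(2 * D) * ((B : EllTwo →L[ℂ] EllTwo) x) j := by
    intro x j
    rw [hB]
    simp only [hA, sub_apply, lp_two_sub_apply, _root_.smul_apply, lp_two_smul_apply, add_apply,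
      lp_two_add_apply, shift_apply, smul_eq_mul, one_apply_eq_self, ← sub_eq_add_neg]
    field_simp
    ring
  refine ⟨-(2 * D)⁻¹ • (↑B⁻¹ : EllTwo →L[ℂ] EllTwo), fun g j => ?_, fun x hx => ?_⟩
  · rw [app]
    have : (B : EllTwo →L[ℂ] EllTwo) ((↑B⁻¹ : EllTwo →L[ℂ] EllTwo) g) = g := by
      rw [← mul_apply_eq_comp, Units.mul_inv]; rfl
    rw [neg_smul, neg_apply, _root_.smul_apply, map_neg, map_smul, this, lp_two_neg_apply,
      lp_two_smul_apply, smul_eq_mul]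
    field_simp
  · have h0 : (B : EllTwo →L[ℂ] EllTwo) x = 0 := by
      refine lp.ext <| funext fun j => ?_
      have := app x j
      rw [hx j, eq_comm, mul_eq_zero] at this
      rcases this with h | h
      · exact absurd h (by simpa using hD0)
      · simpa using h
    have : (↑B⁻¹ : EllTwo →L[ℂ] EllTwo) ((B : EllTwo →L[ℂ] EllTwo) x) = x := by
      rw [← mul_apply_eq_comp, Units.inv_mul]; rfl
    rw [← this, h0, map_zero]

/-! ### Resolvent points of the Hamiltonian -/

/-- A right inverse of an injective operator is also a left inverse: `R (T u - z u) - u` is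
annihilated by `T - z`. -/
theorem mem_unboundedResolventSet_chainHamiltonian {α : ℝ} {z : ℂ} (R : ChainL2 →L[ℂ] ChainL2)
    (h1 : ∀ f, (R f, f + z • R f) ∈ chainGraph α)
    (h2 : ∀ w, (w, z • w) ∈ chainGraph α → w = 0) :
    z ∈ unboundedResolventSet (chainHamiltonian α) := by
  have hg := chainHamiltonian_graph α
  have h1' : ∀ f, ∃ h : R f ∈ (chainHamiltonian α).domain,
      chainHamiltonian α ⟨R f, h⟩ = f + z • R f := by
    intro f
    have := h1 f
    rw [← hg, LinearPMap.mem_graph_iff] at this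
    obtain ⟨y, hy1, hy2⟩ := this
    simp only at hy1 hy2
    have hy : R f ∈ (chainHamiltonian α).domain := hy1 ▸ y.2
    refine ⟨hy, ?_⟩
    rw [← hy2]
    congr 1
    exact Subtype.ext hy1.symm
  refine ⟨R, fun f => ?_, fun u => ?_⟩
  · obtain ⟨h, e⟩ := h1' f
    exact ⟨h, by rw [e]; abel⟩
  · set g := chainHamiltonian α u - z • (u : ChainL2) with hgdef
    have m1 : ((u : ChainL2), chainHamiltonian α u) ∈ chainGraph α := by
      rw [← hg]; exact LinearPMap.mem_graph _ u
    have m2 := (chainGraph α).sub_mem (h1 g) m1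
    rw [Prod.mk_sub_mk] at m2
    have e : g + z • R g - chainHamiltonian α u = z • (R g - u) := by
      rw [hgdef, smul_sub]; abel
    rw [e] at m2
    exact sub_eq_zero.1 (h2 _ m2)

/-- Both spectral inclusions contradict this estimate, one with an eigenfunction, the other with a
singular sequence. -/
theorem exists_bound_of_mem_unboundedResolventSet {α : ℝ} {z : ℂ}
    (h : z ∈ unboundedResolventSet (chainHamiltonian α)) :
    ∃ C : ℝ, 0 ≤ C ∧ ∀ u g, (u, g) ∈ chainGraph α → ‖u‖ ≤ C * ‖g - z • u‖ := by
  obtain ⟨R, -, hR⟩ := h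
  refine ⟨‖R‖, norm_nonneg _, fun u g hug => ?_⟩
  rw [← chainHamiltonian_graph, LinearPMap.mem_graph_iff] at hug
  obtain ⟨y, hy1, hy2⟩ := hug
  simp only at hy1 hy2
  have := hR y
  rw [hy1, hy2] at this
  conv_lhs => rw [← this]
  exact R.le_opNorm _

/-! ### Functions and functionals on an edge -/

theorem edge_integrable (f : EdgeL2) : Integrable f edgeMeasure :=
  (Lp.memLp f).integrable (by norm_num)

theorem exists_integral_norm_le :
    ∃ C : ℝ, 0 ≤ C ∧ ∀ f : EdgeL2, ∫ t, ‖f t‖ ∂edgeMeasure ≤ C * ‖f‖ := by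
  refine ⟨(edgeMeasure univ ^ (1 / (1 : ℝ≥0∞).toReal - 1 / (2 : ℝ≥0∞).toReal)).toReal,
    ENNReal.toReal_nonneg, fun f => ?_⟩
  have h := eLpNorm_le_eLpNorm_mul_rpow_measure_univ (p := 1) (q := 2) (by norm_num)
    (Lp.aestronglyMeasurable f)
  rw [integral_norm_eq_lintegral_enorm (Lp.aestronglyMeasurable f), ← eLpNorm_one_eq_lintegral_enorm,
    Lp.norm_def, mul_comm, ← ENNReal.toReal_mul]
  refine ENNReal.toReal_mono (ENNReal.mul_ne_top (Lp.eLpNorm_ne_top f) ?_) h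
  exact ENNReal.rpow_ne_top_of_nonneg (by norm_num) (measure_ne_top _ _)

theorem exists_bound_edge {g : ℝ → ℂ} (hg : Continuous g) :
    ∃ M : ℝ, 0 ≤ M ∧ ∀ x ∈ Icc 0 Real.pi, ‖g x‖ ≤ M := by
  obtain ⟨M, hM⟩ := isCompact_Icc.exists_bound_of_continuousOn hg.continuousOn (s := Icc 0 Real.pi)
  exact ⟨M, (norm_nonneg _).trans (hM 0 (left_mem_Icc.2 Real.pi_pos.le)), hM⟩

theorem continuous_mul_edge_integrable {g : ℝ → ℂ} (hg : Continuous g) (f : EdgeL2) :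
    Integrable (fun t => g t * f t) edgeMeasure := by
  have h2 : IntegrableOn f (Icc 0 Real.pi) := by
    rw [integrableOn_Icc_iff_integrableOn_Ioo]; exact edge_integrable f
  exact (h2.continuousOn_mul hg.continuousOn isCompact_Icc).mono_set Ioo_subset_Icc_self

theorem edgePrimitive_add {g : ℝ → ℂ} (hg : Continuous g) (f f' : EdgeL2) {x : ℝ}
    (hx : x ∈ Icc 0 Real.pi) : ∫ t in (0 : ℝ)..x, g t * (f + f') t =
      (∫ t in (0 : ℝ)..x, g t * f t) + ∫ t in (0 : ℝ)..x, g t * f' t := by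
  have hs : Ioo 0 x ⊆ Ioo 0 Real.pi := Ioo_subset_Ioo_right hx.2
  simp only [intervalIntegral.integral_of_le hx.1, integral_Ioc_eq_integral_Ioo]
  rw [← integral_add ((continuous_mul_edge_integrable hg f).mono_measure
    (Measure.restrict_mono_set _ hs)) ((continuous_mul_edge_integrable hg f').mono_measure
    (Measure.restrict_mono_set _ hs))]
  refine integral_congr_ae ?_
  filter_upwards [ae_restrict_of_ae_restrict_of_subset hs (Lp.coeFn_add f f')] with t ht
  rw [ht, Pi.add_apply, mul_add]

theorem edgePrimitive_smul (g : ℝ → ℂ) (c : ℂ) (f : EdgeL2) {x : ℝ}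
    (hx : x ∈ Icc 0 Real.pi) : ∫ t in (0 : ℝ)..x, g t * (c • f) t =
      c * ∫ t in (0 : ℝ)..x, g t * f t := by
  have hs : Ioo 0 x ⊆ Ioo 0 Real.pi := Ioo_subset_Ioo_right hx.2
  simp only [intervalIntegral.integral_of_le hx.1, integral_Ioc_eq_integral_Ioo]
  rw [← integral_const_mul]
  refine integral_congr_ae ?_
  filter_upwards [ae_restrict_of_ae_restrict_of_subset hs (Lp.coeFn_smul c f)] with t ht
  rw [ht, Pi.smul_apply, smul_eq_mul]
  ring

/-- Uniformity of `C` in `x` is what later bounds `edgeSol` in the supremum norm. -/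
theorem norm_edgePrimitive_le {g : ℝ → ℂ} (hg : Continuous g) :
    ∃ C : ℝ, 0 ≤ C ∧ ∀ (f : EdgeL2), ∀ x ∈ Icc 0 Real.pi,
      ‖∫ t in (0 : ℝ)..x, g t * f t‖ ≤ C * ‖f‖ := by
  obtain ⟨M, hM0, hM⟩ := exists_bound_edge hg
  obtain ⟨C, hC0, hC⟩ := exists_integral_norm_le
  refine ⟨M * C, by positivity, fun f x hx => ?_⟩
  have hs : Ioo 0 x ⊆ Ioo 0 Real.pi := Ioo_subset_Ioo_right hx.2
  rw [intervalIntegral.integral_of_le hx.1, integral_Ioc_eq_integral_Ioo]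
  calc ‖∫ t in Ioo 0 x, g t * f t‖ ≤ ∫ t in Ioo 0 x, ‖g t * f t‖ := norm_integral_le_integral_norm _
    _ ≤ ∫ t in Ioo 0 Real.pi, ‖g t * f t‖ :=
        setIntegral_mono_set (continuous_mul_edge_integrable hg f).norm
          (Filter.Eventually.of_forall fun t => norm_nonneg _) hs.eventuallyLE
    _ ≤ ∫ t in Ioo 0 Real.pi, M * ‖f t‖ := by
        refine setIntegral_mono_on (continuous_mul_edge_integrable hg f).norm
          ((edge_integrable f).norm.const_mul M) measurableSet_Ioo fun t ht => ?_
        rw [norm_mul]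
        exact mul_le_mul_of_nonneg_right (hM t (Ioo_subset_Icc_self ht)) (norm_nonneg _)
    _ ≤ M * C * ‖f‖ := by
        rw [integral_const_mul, mul_assoc]
        exact mul_le_mul_of_nonneg_left (hC f) hM0

/-- The functional `f ↦ ∫₀ˣ g f` on `L²` of an edge. -/
def edgePrimitiveAt (g : ℝ → ℂ) (hg : Continuous g) (x : ℝ) (hx : x ∈ Icc 0 Real.pi) :
    EdgeL2 →L[ℂ] ℂ :=
  LinearMap.mkContinuous
    { toFun := fun f => ∫ t in (0 : ℝ)..x, g t * f t
      map_add' := fun f f' => edgePrimitive_add hg f f' hx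
      map_smul' := fun c f => edgePrimitive_smul g c f hx }
    (norm_edgePrimitive_le hg).choose fun f =>
      (norm_edgePrimitive_le hg).choose_spec.2 f x hx

@[simp] theorem edgePrimitiveAt_apply (g : ℝ → ℂ) (hg : Continuous g) (x : ℝ)
    (hx : x ∈ Icc 0 Real.pi) (f : EdgeL2) :
    edgePrimitiveAt g hg x hx f = ∫ t in (0 : ℝ)..x, g t * f t := rfl

theorem ContinuousOn.memLp_edge {f : ℝ → ℂ} (hf : ContinuousOn f (Icc 0 Real.pi)) :
    MemLp f 2 edgeMeasure := by
  obtain ⟨M, hM⟩ := isCompact_Icc.exists_bound_of_continuousOn hf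
  exact MemLp.of_bound hf.integrable_edge.aestronglyMeasurable M
    ((ae_restrict_iff' measurableSet_Ioo).2 (Filter.Eventually.of_forall fun x hx =>
      hM x (Ioo_subset_Icc_self hx)))

/-- A linear family of functions, continuous on the closed edge and uniformly bounded by the
norm of the parameter, defines a bounded operator into `L²` of the edge. -/
theorem exists_edge_operator {X : Type*} [NormedAddCommGroup X] [NormedSpace ℂ X]
    (Φ : X → ℝ → ℂ) (hc : ∀ p, ContinuousOn (Φ p) (Icc 0 Real.pi))
    (hadd : ∀ p q, ∀ x ∈ Icc 0 Real.pi, Φ (p + q) x = Φ p x + Φ q x)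
    (hsmul : ∀ (c : ℂ) p, ∀ x ∈ Icc 0 Real.pi, Φ (c • p) x = c * Φ p x)
    {C : ℝ} (hC0 : 0 ≤ C) (hC : ∀ p, ∀ x ∈ Icc 0 Real.pi, ‖Φ p x‖ ≤ C * ‖p‖) :
    ∃ S : X →L[ℂ] EdgeL2, ∀ p, S p =ᵐ[edgeMeasure] Φ p := by
  have hae : ∀ {q : ℝ → Prop}, (∀ x ∈ Icc 0 Real.pi, q x) → ∀ᵐ x ∂edgeMeasure, q x := fun h =>
    (ae_restrict_iff' measurableSet_Ioo).2 (Filter.Eventually.of_forall fun x hx =>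
      h x (Ioo_subset_Icc_self hx))
  refine ⟨LinearMap.mkContinuous
    { toFun := fun p => (hc p).memLp_edge.toLp (Φ p)
      map_add' := fun p q => ?_
      map_smul' := fun c p => ?_ } (measureUnivNNReal edgeMeasure ^ (2 : ℝ≥0∞).toReal⁻¹ * C)
      fun p => ?_, fun p => (hc p).memLp_edge.coeFn_toLp⟩
  · refine Lp.ext ?_
    filter_upwards [(hc (p + q)).memLp_edge.coeFn_toLp, (hc p).memLp_edge.coeFn_toLp,
      (hc q).memLp_edge.coeFn_toLp, Lp.coeFn_add ((hc p).memLp_edge.toLp (Φ p))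
      ((hc q).memLp_edge.toLp (Φ q)), hae (hadd p q)] with x h1 h2 h3 h4 h5
    rw [h1, h4, Pi.add_apply, h2, h3, h5]
  · refine Lp.ext ?_
    filter_upwards [(hc (c • p)).memLp_edge.coeFn_toLp, (hc p).memLp_edge.coeFn_toLp,
      Lp.coeFn_smul c ((hc p).memLp_edge.toLp (Φ p)), hae (hsmul c p)] with x h1 h2 h4 h5
    rw [h1, h5, RingHom.id_apply, h4, Pi.smul_apply, h2, smul_eq_mul]
  · rw [mul_assoc]
    refine Lp.norm_le_of_ae_bound (by positivity) ?_
    filter_upwards [(hc p).memLp_edge.coeFn_toLp, hae (hC p)] with x h1 h2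
    simpa [h1] using h2

/-! ### Solutions of `-u'' = k² u + f` on an edge -/

/-- The solution of `u'' = -k² u` with `u 0 = 1`, `u' 0 = 0`. -/
def cosSol (k : ℂ) (x : ℝ) : ℂ := Complex.cos (k * x)

/-- The solution of `u'' = -k² u` with `u 0 = 0`, `u' 0 = 1`. -/
def sinSol (k : ℂ) (x : ℝ) : ℂ := Complex.sin (k * x) / k

theorem cosSol_zero (k : ℂ) : cosSol k 0 = 1 := by simp [cosSol]

theorem sinSol_zero (k : ℂ) : sinSol k 0 = 0 := by simp [sinSol]

section Solutions

variable {k : ℂ}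

theorem hasDerivAt_cosSol (hk : k ≠ 0) (x : ℝ) :
    HasDerivAt (cosSol k) (-k ^ 2 * sinSol k x) x := by
  have h : HasDerivAt (fun x : ℝ => k * (x : ℂ)) k x := by
    simpa using (Complex.ofRealCLM.hasDerivAt (x := x)).const_mul k
  exact ((Complex.hasDerivAt_cos (k * x)).comp x h).congr_deriv (by simp only [sinSol]; field_simp)

theorem hasDerivAt_sinSol (hk : k ≠ 0) (x : ℝ) : HasDerivAt (sinSol k) (cosSol k x) x := by
  have h : HasDerivAt (fun x : ℝ => k * (x : ℂ)) k x := by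
    simpa using (Complex.ofRealCLM.hasDerivAt (x := x)).const_mul k
  exact (((Complex.hasDerivAt_sin (k * x)).comp x h).div_const k).congr_deriv
    (by change Complex.cos (k * x) * k / k = Complex.cos (k * x); field_simp)

theorem continuous_cosSol (k : ℂ) : Continuous (cosSol k) := by unfold cosSol; fun_prop

theorem continuous_neg_cosSol (k : ℂ) : Continuous (fun x => -cosSol k x) :=
  (continuous_cosSol k).neg

theorem continuous_sinSol (k : ℂ) : Continuous (sinSol k) := by unfold sinSol; fun_prop

theorem cosSol_sq_add (hk : k ≠ 0) (x : ℝ) : cosSol k x ^ 2 + k ^ 2 * sinSol k x ^ 2 = 1 := by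
  have := Complex.sin_sq_add_cos_sq (k * x)
  simp only [cosSol, sinSol]
  field_simp
  linear_combination this

/-- The solution of `-u'' = k² u + f` with `u 0 = a`, `u' 0 = b` (variation of constants). -/
def edgeSol (k a b : ℂ) (f : ℝ → ℂ) (x : ℝ) : ℂ :=
  cosSol k x * (a + ∫ t in (0 : ℝ)..x, sinSol k t * f t) +
    sinSol k x * (b + ∫ t in (0 : ℝ)..x, -cosSol k t * f t)

/-- The derivative of `edgeSol`. -/
def edgeSolDeriv (k a b : ℂ) (f : ℝ → ℂ) (x : ℝ) : ℂ :=
  -k ^ 2 * sinSol k x * (a + ∫ t in (0 : ℝ)..x, sinSol k t * f t) +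
    cosSol k x * (b + ∫ t in (0 : ℝ)..x, -cosSol k t * f t)

theorem continuousOn_add_edgePrimitive {g : ℝ → ℂ} (hg : Continuous g) (f : EdgeL2) (a : ℂ) :
    ContinuousOn (fun x => a + ∫ t in (0 : ℝ)..x, g t * f t) (Icc 0 Real.pi) :=
  continuousOn_const.add (continuousOn_primitive_edge (continuous_mul_edge_integrable hg f))

theorem continuousOn_edgeSol (k a b : ℂ) (f : EdgeL2) :
    ContinuousOn (edgeSol k a b f) (Icc 0 Real.pi) :=
  ((continuous_cosSol k).continuousOn.mul
    (continuousOn_add_edgePrimitive (continuous_sinSol k) f a)).add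
  ((continuous_sinSol k).continuousOn.mul
    (continuousOn_add_edgePrimitive (continuous_neg_cosSol k) f b))

theorem continuousOn_edgeSolDeriv (k a b : ℂ) (f : EdgeL2) :
    ContinuousOn (edgeSolDeriv k a b f) (Icc 0 Real.pi) :=
  (((continuous_sinSol k).const_mul (-k ^ 2)).continuousOn.mul
    (continuousOn_add_edgePrimitive (continuous_sinSol k) f a)).add
  ((continuous_cosSol k).continuousOn.mul
    (continuousOn_add_edgePrimitive (continuous_neg_cosSol k) f b))

/-- The coefficients `A = a + ∫ sinSol f` and `B = b - ∫ cosSol f` satisfy `cosSol A' + sinSol B' =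
0`, so they do not contribute to the first derivative. In the second they contribute `-(k² sinSol² +
cosSol²) f = -f`. -/
theorem isW22OnEdge_edgeSol (hk : k ≠ 0) (a b : ℂ) (f U : EdgeL2)
    (hU : U =ᵐ[edgeMeasure] edgeSol k a b f) :
    IsW22OnEdge U (-(f + k ^ 2 • U)) (edgeSol k a b f) (edgeSolDeriv k a b f) := by
  have i1 := continuous_mul_edge_integrable (continuous_sinSol k) f
  have i2 := continuous_mul_edge_integrable (continuous_neg_cosSol k) f
  refine ⟨hU, continuousOn_edgeSol k a b f, continuousOn_edgeSolDeriv k a b f, ?_, ?_⟩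
  · have := (hasWeakDerivOnEdge_mul_primitive (hasDerivAt_cosSol hk)
      ((continuous_sinSol k).const_mul _) i1 a).add
      (hasWeakDerivOnEdge_mul_primitive (hasDerivAt_sinSol hk) (continuous_cosSol k) i2 b)
    refine this.congr_right (Filter.Eventually.of_forall fun x => ?_)
    simp only [Pi.add_apply, edgeSolDeriv]
    ring
  · have := (hasWeakDerivOnEdge_mul_primitive
      (fun x => (hasDerivAt_sinSol hk x).const_mul (-k ^ 2))
      ((continuous_cosSol k).const_mul _) i1 a).add
      (hasWeakDerivOnEdge_mul_primitive (hasDerivAt_cosSol hk)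
      ((continuous_sinSol k).const_mul _) i2 b)
    refine this.congr_right ?_
    filter_upwards [Lp.coeFn_neg (f + k ^ 2 • U), Lp.coeFn_add f (k ^ 2 • U),
      Lp.coeFn_smul (k ^ 2) U, hU] with x h1 h2 h3 h4
    rw [h1, Pi.neg_apply, h2]
    simp only [Pi.add_apply]
    rw [h3, Pi.smul_apply, h4, smul_eq_mul]
    simp only [edgeSol]
    linear_combination -f x * cosSol_sq_add hk x

/-- The operator `(a, b, f) ↦ edgeSol k a b f`. -/
theorem exists_edgeSol_operator (k : ℂ) :
    ∃ S : ℂ × ℂ × EdgeL2 →L[ℂ] EdgeL2, ∀ a b f, S (a, b, f) =ᵐ[edgeMeasure] edgeSol k a b f := by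
  obtain ⟨M, hM0, hM⟩ := exists_bound_edge (continuous_cosSol k)
  obtain ⟨N, hN0, hN⟩ := exists_bound_edge (continuous_sinSol k)
  obtain ⟨C, hC0, hC⟩ := norm_edgePrimitive_le (continuous_sinSol k)
  obtain ⟨D, hD0, hD⟩ := norm_edgePrimitive_le (continuous_neg_cosSol k)
  obtain ⟨S, hS⟩ := exists_edge_operator
    (fun p : ℂ × ℂ × EdgeL2 => edgeSol k p.1 p.2.1 p.2.2)
    (fun p => continuousOn_edgeSol k _ _ _)
    (fun p q x hx => by
      simp only [edgeSol, Prod.fst_add, Prod.snd_add]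
      rw [edgePrimitive_add (continuous_sinSol k) _ _ hx,
        edgePrimitive_add (continuous_neg_cosSol k) _ _ hx]
      ring)
    (fun c p x hx => by
      simp only [edgeSol, Prod.smul_fst, Prod.smul_snd]
      rw [edgePrimitive_smul _ _ _ hx, edgePrimitive_smul _ _ _ hx, smul_eq_mul, smul_eq_mul]
      ring)
    (C := M * (1 + C) + N * (1 + D)) (by positivity)
    (fun p x hx => by
      have b1 : ‖p.1‖ ≤ ‖p‖ := norm_fst_le p
      have b2 : ‖p.2.1‖ ≤ ‖p‖ := (norm_fst_le p.2).trans (norm_snd_le p)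
      have b3 : ‖p.2.2‖ ≤ ‖p‖ := (norm_snd_le p.2).trans (norm_snd_le p)
      have c1 := (hC p.2.2 x hx).trans (mul_le_mul_of_nonneg_left b3 hC0)
      have c2 := (hD p.2.2 x hx).trans (mul_le_mul_of_nonneg_left b3 hD0)
      refine (norm_add_le _ _).trans ?_
      rw [norm_mul, norm_mul, add_mul, mul_assoc, mul_assoc]
      gcongr
      · exact hM x hx
      · exact (norm_add_le _ _).trans (by linarith)
      · exact hN x hx
      · exact (norm_add_le _ _).trans (by linarith))
  exact ⟨S, fun a b f => hS (a, b, f)⟩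

theorem edgeSol_at_zero (k a b : ℂ) (f : ℝ → ℂ) : edgeSol k a b f 0 = a := by
  simp [edgeSol, cosSol_zero, sinSol_zero]

theorem edgeSolDeriv_at_zero (k a b : ℂ) (f : ℝ → ℂ) : edgeSolDeriv k a b f 0 = b := by
  simp [edgeSolDeriv, cosSol_zero, sinSol_zero]

/-- Uniqueness for the equation `u'' = -k² u` in the weak sense. -/
theorem eq_cosSol_add_sinSol (hk : k ≠ 0) {u v : ℝ → ℂ} (hu : ContinuousOn u (Icc 0 Real.pi))
    (hv : ContinuousOn v (Icc 0 Real.pi)) (huv : HasWeakDerivOnEdge u v)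
    (hvu : HasWeakDerivOnEdge v (fun x => -k ^ 2 * u x)) :
    ∀ x ∈ Icc 0 Real.pi, u x = cosSol k x * u 0 + sinSol k x * v 0 ∧
      v x = -k ^ 2 * sinSol k x * u 0 + cosSol k x * v 0 := by
  -- Continuity of the right side turns weak derivatives into classical ones in the interior.
  have deriv_of : ∀ {f g : ℝ → ℂ}, ContinuousOn g (Icc 0 Real.pi) →
      (∀ x ∈ Icc 0 Real.pi, f x = f 0 + ∫ t in (0 : ℝ)..x, g t) →
      ∀ x ∈ Ioo 0 Real.pi, HasDerivAt f (g x) x := by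
    intro f g hg hfg x hx
    have hgx : ContinuousAt g x := hg.continuousAt (Icc_mem_nhds hx.1 hx.2)
    have hi : IntervalIntegrable g volume 0 x :=
      (hg.mono (by rw [uIcc_of_le hx.1.le]; exact Icc_subset_Icc_right hx.2.le)).intervalIntegrable
    have hm : StronglyMeasurableAtFilter g (nhds x) volume :=
      (hg.mono Ioo_subset_Icc_self).stronglyMeasurableAtFilter isOpen_Ioo x hx
    refine ((intervalIntegral.integral_hasDerivAt_right hi hm hgx).const_add
      (f 0)).congr_of_eventuallyEq ?_
    filter_upwards [Icc_mem_nhds hx.1 hx.2] with y hy using hfg y hy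
  have hg : ContinuousOn (fun x => -k ^ 2 * u x) (Icc 0 Real.pi) := continuousOn_const.mul hu
  have du := deriv_of hv (huv.eq_add_integral hu hv)
  have dv := deriv_of hg (hvu.eq_add_integral hv hg)
  have const_of : ∀ {f : ℝ → ℂ}, ContinuousOn f (Icc 0 Real.pi) →
      (∀ x ∈ Ioo 0 Real.pi, HasDerivAt f 0 x) → ∀ x ∈ Icc 0 Real.pi, f x = f 0 := by
    intro f hf hd x hx
    have := intervalIntegral.integral_eq_sub_of_hasDerivAt_of_le hx.1
      (hf.mono (Icc_subset_Icc_right hx.2)) (f' := fun _ => 0)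
      (fun y hy => hd y ⟨hy.1, hy.2.trans_le hx.2⟩) (by simp)
    rw [intervalIntegral.integral_zero] at this
    exact sub_eq_zero.1 this.symm
  have hcc := (continuous_cosSol k).continuousOn (s := Icc 0 Real.pi)
  have hcs := (continuous_sinSol k).continuousOn (s := Icc 0 Real.pi)
  -- `A` and `B` are the Wronskians of `u` with the two fundamental solutions. Being constant, they
  -- equal `u 0` and `v 0`; the linear system has determinant one and is solved for `u x`, `v x` at
  -- the end.
  have A := const_of (f := fun x => cosSol k x * u x - sinSol k x * v x)
    ((hcc.mul hu).sub (hcs.mul hv)) (fun x hx => by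
      exact (((hasDerivAt_cosSol hk x).mul (du x hx)).sub
        ((hasDerivAt_sinSol hk x).mul (dv x hx))).congr_deriv (by ring))
  have B := const_of (f := fun x => k ^ 2 * sinSol k x * u x + cosSol k x * v x)
    (((continuousOn_const.mul hcs).mul hu).add (hcc.mul hv)) (fun x hx => by
      exact ((((hasDerivAt_sinSol hk x).const_mul (k ^ 2)).mul (du x hx)).add
        ((hasDerivAt_cosSol hk x).mul (dv x hx))).congr_deriv (by ring))
  intro x hx
  have a := A x hx
  have b := B x hx
  have e := cosSol_sq_add hk x
  simp only [cosSol_zero, sinSol_zero] at a b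
  constructor
  · linear_combination cosSol k x * a + sinSol k x * b - u x * e
  · linear_combination -k ^ 2 * sinSol k x * a + cosSol k x * b - v x * e

end Solutions

/-! ### The resolvent outside the bands -/

theorem SummablePull.ring_edge (m : ℤ) (b : Bool) :
    SummablePull (fun j : ℤ => ((j + m, b) : ChainEdge)) 1 :=
  SummablePull.of_injective fun i j h => by simpa using h

theorem SummablePull.edge_vertex (m : ℤ) : SummablePull (fun e : ChainEdge => e.1 + m) (2 * 1) :=
  SummablePull.comp (τ := (Prod.fst : ℤ × Bool → ℤ)) (σ := fun j : ℤ => j + m) (by norm_num)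
    SummablePull.fst (SummablePull.of_injective (add_left_injective m))

theorem pi_mem_edge : Real.pi ∈ Icc 0 Real.pi := right_mem_Icc.2 Real.pi_pos.le

/-- The value at `π` of the solution with zero initial data, as a functional of the right side. -/
def endValue (k : ℂ) : EdgeL2 →L[ℂ] ℂ :=
  cosSol k Real.pi • edgePrimitiveAt (sinSol k) (continuous_sinSol k) Real.pi pi_mem_edge +
    sinSol k Real.pi •
      edgePrimitiveAt (fun x => -cosSol k x) (continuous_neg_cosSol k) Real.pi pi_mem_edge

/-- The derivative at `π` of the solution with zero initial data. -/
def endDeriv (k : ℂ) : EdgeL2 →L[ℂ] ℂ :=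
  (-k ^ 2 * sinSol k Real.pi) •
      edgePrimitiveAt (sinSol k) (continuous_sinSol k) Real.pi pi_mem_edge +
    cosSol k Real.pi •
      edgePrimitiveAt (fun x => -cosSol k x) (continuous_neg_cosSol k) Real.pi pi_mem_edge

theorem edgeSol_at_pi (k a b : ℂ) (f : EdgeL2) :
    edgeSol k a b f Real.pi = cosSol k Real.pi * a + sinSol k Real.pi * b + endValue k f := by
  simp only [edgeSol, endValue, add_apply, _root_.smul_apply, edgePrimitiveAt_apply, smul_eq_mul]
  ring

theorem edgeSolDeriv_at_pi (k a b : ℂ) (f : EdgeL2) :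
    edgeSolDeriv k a b f Real.pi =
      -k ^ 2 * sinSol k Real.pi * a + cosSol k Real.pi * b + endDeriv k f := by
  simp only [edgeSolDeriv, endDeriv, add_apply, _root_.smul_apply, edgePrimitiveAt_apply,
    smul_eq_mul]
  ring

/-- The discriminant of the chain. -/
def chainDiscr (α : ℝ) (k : ℂ) : ℂ := cosSol k Real.pi + (α / 4 : ℂ) * sinSol k Real.pi

variable {α : ℝ} {k : ℂ}

/-- The right side of the vertex equation. -/
def vertexSource (k : ℂ) : ChainL2 →L[ℂ] EllTwo :=
  -- This is the part of the δ-condition coming from `f`, multiplied by `s / 2` and moved to the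
  -- right. The term for ring `j - 1` combines `endDeriv` with the change of initial slope
  -- `-endValue / s`.
  (2⁻¹ : ℂ) • ∑ b : Bool, (lpPull (SummablePull.ring_edge 0 b) (endValue k) -
    lpPull (SummablePull.ring_edge (-1) b)
      (cosSol k Real.pi • endValue k - sinSol k Real.pi • endDeriv k))

theorem vertexSource_apply (k : ℂ) (f : ChainL2) (j : ℤ) : vertexSource k f j =
    2⁻¹ * ∑ b : Bool, (endValue k (f (j, b)) - (cosSol k Real.pi * endValue k (f (j - 1, b)) -
      sinSol k Real.pi * endDeriv k (f (j - 1, b)))) := by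
  simp [vertexSource, lp_two_smul_apply, lp_two_add_apply, lp_two_sub_apply, ← sub_eq_add_neg]
  ring

/-- Existence of the resolvent operator: edgewise solutions with matching vertex data. -/
theorem exists_chain_solution_operator (hk : k ≠ 0) (hs : sinSol k Real.pi ≠ 0)
    (hD : 1 < ‖chainDiscr α k‖) :
    ∃ R : ChainL2 →L[ℂ] ChainL2, ∀ f, (R f, f + k ^ 2 • R f) ∈ chainGraph α := by
  obtain ⟨S, hS⟩ := exists_edgeSol_operator k
  obtain ⟨K, hK, -⟩ := exists_discrete_resolvent hD
  set c := cosSol k Real.pi with hc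
  set s := sinSol k Real.pi with hsdef
  let T : ChainL2 →L[ℂ] EllTwo := K ∘L vertexSource k
  let i1 : ℂ →L[ℂ] ℂ × ℂ × EdgeL2 := ContinuousLinearMap.inl ℂ ℂ (ℂ × EdgeL2)
  let i2 : ℂ →L[ℂ] ℂ × ℂ × EdgeL2 :=
    ContinuousLinearMap.inr ℂ ℂ (ℂ × EdgeL2) ∘L ContinuousLinearMap.inl ℂ ℂ EdgeL2
  let i3 : EdgeL2 →L[ℂ] ℂ × ℂ × EdgeL2 :=
    ContinuousLinearMap.inr ℂ ℂ (ℂ × EdgeL2) ∘L ContinuousLinearMap.inr ℂ ℂ EdgeL2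
  -- The edge data depend on the left vertex value, the right vertex value and `f` on the edge
  -- itself; one summand for each.
  let R : ChainL2 →L[ℂ] ChainL2 :=
    lpPull (SummablePull.edge_vertex 0) (S ∘L (i1 - (c / s) • i2)) ∘L T +
      lpPull (SummablePull.edge_vertex 1) (S ∘L (s⁻¹ • i2)) ∘L T +
      lpPull (SummablePull.of_injective (fun _ _ h => h : Function.Injective (id : ChainEdge → _)))
        (S ∘L (i3 - s⁻¹ • (i2 ∘L endValue k)))
  have hR : ∀ (f : ChainL2) (e : ChainEdge), R f e = S (T f e.1,
      (T f (e.1 + 1) - c * T f e.1 - endValue k (f e)) / s, f e) := by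
    intro f e
    have : R f e = S ((i1 - (c / s) • i2) (T f (e.1 + 0))) + S ((s⁻¹ • i2) (T f (e.1 + 1))) +
      S ((i3 - s⁻¹ • (i2 ∘L endValue k)) (f e)) := rfl
    rw [this, ← map_add, ← map_add]
    congr 1
    simp only [i1, i2, i3, add_zero, sub_apply, _root_.smul_apply, ContinuousLinearMap.coe_comp,
      Function.comp_apply, ContinuousLinearMap.inl_apply, ContinuousLinearMap.inr_apply,
      Prod.smul_mk, smul_zero, Prod.mk_sub_mk, Prod.mk_add_mk, smul_eq_mul, sub_zero, zero_sub,
      Prod.neg_mk]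
    refine Prod.ext (by simp) (Prod.ext ?_ (by simp))
    simp only
    field_simp
    ring
  refine ⟨R, fun f => ?_⟩
  set ψ := T f with hψ
  -- The initial slope for which the solution reaches the value `ψ (e.1 + 1)` at `π`.
  set b : ChainEdge → ℂ := fun e => (ψ (e.1 + 1) - c * ψ e.1 - endValue k (f e)) / s with hb
  have hend : ∀ e : ChainEdge, edgeSol k (ψ e.1) (b e) (f e) Real.pi = ψ (e.1 + 1) := by
    intro e
    rw [edgeSol_at_pi]
    simp only [hb]
    field_simp
    ring
  refine ⟨fun e => edgeSol k (ψ e.1) (b e) (f e), fun e => edgeSolDeriv k (ψ e.1) (b e) (f e),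
    fun e => ?_, fun j => ⟨?_, ?_, ?_, ?_⟩⟩
  · refine isW22OnEdge_edgeSol hk _ _ (f e) (R f e) ?_
    rw [hR]
    exact hS _ _ _
  · simp only [edgeSol_at_zero]
  · exact (hend (j - 1, true)).trans (by simp [edgeSol_at_zero])
  · exact (hend (j - 1, false)).trans (by simp [edgeSol_at_zero])
  · have key : ψ (j + 1) + ψ (j - 1) - 2 * chainDiscr α k * ψ j = vertexSource k f j :=
      hK (vertexSource k f) j
    rw [vertexSource_apply, Fintype.sum_bool, chainDiscr, ← hc, ← hsdef] at key
    have e := cosSol_sq_add hk Real.pi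
    rw [← hc, ← hsdef] at e
    simp only [edgeSolDeriv_at_zero, edgeSolDeriv_at_pi, edgeSol_at_zero, hb, sub_add_cancel,
      ← hc, ← hsdef]
    field_simp
    linear_combination 2 * key + 2 * ψ (j - 1) * e

/-- The vertex values of an eigenfunction solve the homogeneous difference equation. Uniqueness is
available only in `ℓ²`, so they must first be bounded by the edgewise `L²` norms. -/
theorem eq_zero_of_eigen (hk : k ≠ 0) (hs : sinSol k Real.pi ≠ 0) (hD : 1 < ‖chainDiscr α k‖)
    (w : ChainL2) (hw : (w, k ^ 2 • w) ∈ chainGraph α) : w = 0 := by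
  obtain ⟨S, hS⟩ := exists_edgeSol_operator k
  obtain ⟨-, -, hK⟩ := exists_discrete_resolvent hD
  obtain ⟨u, v, huv, hδ⟩ := hw
  set c := cosSol k Real.pi with hc
  set s := sinSol k Real.pi with hsdef
  have hpi : Real.pi ∈ Icc 0 Real.pi := pi_mem_edge
  have h0 : ∀ a b : ℂ, ∀ x ∈ Ioo 0 Real.pi,
      edgeSol k a b (0 : EdgeL2) x = cosSol k x * a + sinSol k x * b := by
    intro a b x hx
    have hz : ∀ g : ℝ → ℂ, ∫ t in (0 : ℝ)..x, g t * (0 : EdgeL2) t = 0 := fun g => by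
      simpa using edgePrimitive_smul g 0 0 (Ioo_subset_Icc_self hx)
    rw [edgeSol, hz (sinSol k), hz (fun t => -cosSol k t), add_zero, add_zero]
  have hsol : ∀ e, ∀ x ∈ Icc 0 Real.pi, u e x = cosSol k x * u e 0 + sinSol k x * v e 0 ∧
      v e x = -k ^ 2 * sinSol k x * u e 0 + cosSol k x * v e 0 := by
    intro e
    refine eq_cosSol_add_sinSol hk (huv e).continuousOn (huv e).continuousOn_deriv (huv e).weakDeriv
      ((huv e).weakDeriv_deriv.congr_right ?_)
    have a1 : (k ^ 2 • w) e = k ^ 2 • w e := rfl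
    simp only [a1]
    filter_upwards [Lp.coeFn_neg (k ^ 2 • w e), Lp.coeFn_smul (k ^ 2) (w e), (huv e).ae_eq]
      with x h1 h2 h3
    rw [h1, Pi.neg_apply, h2, Pi.smul_apply, h3, smul_eq_mul]
    ring
  have hw : ∀ e, w e = S (u e 0, v e 0, 0) := by
    intro e
    refine Lp.ext ?_
    filter_upwards [hS (u e 0) (v e 0) 0, (huv e).ae_eq, ae_restrict_mem measurableSet_Ioo]
      with x h1 h2 hx
    rw [h1, h0 _ _ x hx, h2, (hsol e x (Ioo_subset_Icc_self hx)).1]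
  -- Initial data map injectively to solutions; as their space is finite-dimensional, `L` is bounded
  -- below.
  let L : ℂ × ℂ →ₗ[ℂ] EdgeL2 :=
    { toFun := fun p => S (p.1, p.2, 0)
      map_add' := fun p q => by rw [← map_add]; simp
      map_smul' := fun r p => by rw [← map_smul]; simp }
  have hL : L.ker = ⊥ := by
    refine LinearMap.ker_eq_bot'.2 fun p hp => ?_
    have hae : (fun x => cosSol k x * p.1 + sinSol k x * p.2) =ᵐ[edgeMeasure] fun _ => 0 := by
      have hz : S (p.1, p.2, 0) = 0 := hp
      filter_upwards [hS p.1 p.2 0, Lp.coeFn_zero ℂ 2 edgeMeasure, ae_restrict_mem measurableSet_Ioo]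
        with x h1 h2 hx
      rw [← h0 _ _ x hx, ← h1, hz, h2]; rfl
    rw [edgeMeasure, restrict_Ioo_eq_restrict_Icc] at hae
    have heq := Measure.eqOn_Icc_of_ae_eq volume Real.pi_pos.ne hae
      (((continuous_cosSol k).mul continuous_const).add
        ((continuous_sinSol k).mul continuous_const)).continuousOn continuousOn_const
    have e0 := heq (left_mem_Icc.2 Real.pi_pos.le)
    have e1 := heq hpi
    simp only [cosSol_zero, sinSol_zero] at e0
    have p1 : p.1 = 0 := by simpa using e0
    simp only [p1, mul_zero, zero_add] at e1
    exact Prod.ext p1 ((mul_eq_zero.1 e1).resolve_left hs)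
  obtain ⟨B, hB0, hB⟩ := L.exists_antilipschitzWith hL
  have hbound : ∀ e, ‖u e 0‖ ≤ B * ‖w e‖ := fun e => by
    have := hB.le_mul_norm (map_zero L) (u e 0, v e 0)
    rw [hw e]
    exact (norm_fst_le ((u e 0, v e 0) : ℂ × ℂ)).trans this
  have hsum : Summable fun j : ℤ => ‖u (j, false) 0‖ ^ 2 := by
    have h1 : Summable fun j : ℤ => ‖w (j, false)‖ ^ 2 :=
      (lp_two_summable w).comp_injective (i := fun j : ℤ => ((j, false) : ChainEdge))
        fun i j h => by simpa using h
    refine Summable.of_nonneg_of_le (fun j => by positivity) (fun j => ?_)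
      (h1.mul_left ((B : ℝ) ^ 2))
    rw [← mul_pow]
    gcongr
    exact hbound _
  let ψ : EllTwo := ⟨fun j => u (j, false) 0, memℓp_two_of_summable hsum⟩
  have hψ : ∀ j, ψ j = u (j, false) 0 := fun j => rfl
  have hu0 : ∀ e : ChainEdge, u e 0 = ψ e.1 := by
    rintro ⟨j, b⟩
    cases b
    · rfl
    · exact (hδ j).1
  have hupi : ∀ e : ChainEdge, u e Real.pi = ψ (e.1 + 1) := by
    rintro ⟨j, b⟩
    have := hδ (j + 1)
    simp only [DeltaCoupling, add_sub_cancel_right] at this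
    cases b
    · exact this.2.2.1
    · exact this.2.1
  have hv0 : ∀ e : ChainEdge, v e 0 = (ψ (e.1 + 1) - c * ψ e.1) / s := by
    intro e
    have := (hsol e _ hpi).1
    rw [hupi, hu0] at this
    rw [this]
    field_simp
    ring
  have hzero : ψ = 0 := by
    refine hK ψ fun j => ?_
    have key := (hδ j).2.2.2
    have e := cosSol_sq_add hk Real.pi
    rw [← hc, ← hsdef] at e
    simp only [(hsol _ _ hpi).2, hv0, hu0, sub_add_cancel, ← hc, ← hsdef] at key
    field_simp at key
    simp only [chainDiscr, ← hc, ← hsdef]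
    linear_combination key / 2 - ψ (j - 1) * e
  have hψ0 : ∀ j, ψ j = 0 := fun j => by rw [hzero]; rfl
  refine lp.ext (funext fun e => ?_)
  rw [hw e, hv0, hu0, hψ0, hψ0, mul_zero, sub_zero, zero_div]
  exact map_zero S

theorem mem_resolventSet_of_one_lt_discr (hk : k ≠ 0) (hs : sinSol k Real.pi ≠ 0)
    (hD : 1 < ‖chainDiscr α k‖) : k ^ 2 ∈ unboundedResolventSet (chainHamiltonian α) := by
  obtain ⟨R, hR⟩ := exists_chain_solution_operator hk hs hD
  exact mem_unboundedResolventSet_chainHamiltonian R hR fun w => eq_zero_of_eigen hk hs hD w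

/-! ### Singular sequences in the bands -/

/-- The class in `L²` of an edge of a continuous function. -/
def edgeLp : C(ℝ, ℂ) →ₗ[ℂ] EdgeL2 where
  toFun f := (f.continuous.continuousOn.memLp_edge).toLp f
  map_add' _ _ := rfl
  map_smul' _ _ := rfl

theorem edgeLp_ae (f : C(ℝ, ℂ)) : edgeLp f =ᵐ[edgeMeasure] f :=
  MemLp.coeFn_toLp f.continuous.continuousOn.memLp_edge

theorem eqOn_zero_of_edgeLp_eq_zero {f : C(ℝ, ℂ)} (hf : edgeLp f = 0) :
    ∀ x ∈ Icc 0 Real.pi, f x = 0 := by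
  have h : f =ᵐ[edgeMeasure] fun _ => (0 : ℂ) := by
    filter_upwards [edgeLp_ae f, Lp.coeFn_zero ℂ 2 edgeMeasure] with x h1 h2
    rw [← h1, hf, h2]; rfl
  rw [edgeMeasure, restrict_Ioo_eq_restrict_Icc] at h
  exact Measure.eqOn_Icc_of_ae_eq volume Real.pi_pos.ne h f.continuous.continuousOn
    continuousOn_const

/-- The operator acts on functions that are twice differentiable on the edges as expected. -/
theorem mem_chainGraph_of_hasDerivAt {α : ℝ} (U G : ChainL2) (u v g : ChainEdge → C(ℝ, ℂ))
    (hu : ∀ e x, HasDerivAt (u e) (v e x) x) (hv : ∀ e x, HasDerivAt (v e) (-g e x) x)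
    (hU : ∀ e, U e = edgeLp (u e)) (hG : ∀ e, G e = edgeLp (g e))
    (hδ : ∀ j, DeltaCoupling α (fun e => u e) (fun e => v e) j) : (U, G) ∈ chainGraph α := by
  refine ⟨fun e => u e, fun e => v e, fun e => ?_, hδ⟩
  refine isW22OnEdge_of_hasDerivAt (hu e) (hv e) (g e).continuous.neg ?_ ?_
  · simp only [hU]; exact edgeLp_ae _
  · simp only [hG, ← map_neg]; exact edgeLp_ae _

theorem memℓp_of_ring_support {f : ChainEdge → EdgeL2} (s : Finset ℤ)
    (h : ∀ e : ChainEdge, e.1 ∉ s → f e = 0) : Memℓp f 2 := by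
  refine memℓp_two_of_summable (summable_of_ne_finset_zero (s := s ×ˢ Finset.univ) fun e he => ?_)
  rw [h e (fun h' => he (Finset.mem_product.2 ⟨h', Finset.mem_univ _⟩))]
  simp

/-- `sinSol` on one semicircle of ring `0` and its negative on the other vanish at the vertices, and
their outgoing derivatives cancel there, whatever `α` is. -/
theorem mem_spectrum_of_sinSol_eq_zero (hk : k ≠ 0) (hs : sinSol k Real.pi = 0) :
    k ^ 2 ∈ unboundedSpectrum (chainHamiltonian α) := by
  intro hres
  obtain ⟨C, -, hC⟩ := exists_bound_of_mem_unboundedResolventSet hres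
  let S : C(ℝ, ℂ) := ⟨sinSol k, continuous_sinSol k⟩
  let c : C(ℝ, ℂ) := ⟨cosSol k, continuous_cosSol k⟩
  let σ : ChainEdge → ℂ := fun e => if e.1 = 0 then (if e.2 then 1 else -1) else 0
  let U : ChainL2 := ⟨fun e => σ e • edgeLp S, memℓp_of_ring_support {0} fun e he => by
    have : e.1 ≠ 0 := by simpa using he
    simp [σ, this]⟩
  have hU : ∀ e, U e = σ e • edgeLp S := fun e => rfl
  have hmem : (U, k ^ 2 • U) ∈ chainGraph α := by
    refine mem_chainGraph_of_hasDerivAt U (k ^ 2 • U) (fun e => σ e • S) (fun e => σ e • c)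
      (fun e => (k ^ 2 * σ e) • S) (fun e x => (hasDerivAt_sinSol hk x).const_mul (σ e))
      (fun e x => ((hasDerivAt_cosSol hk x).const_mul (σ e)).congr_deriv ?_)
      (fun e => by rw [map_smul, hU]) (fun e => ?_) fun j => ?_
    · simp [S]; ring
    · rw [map_smul, mul_smul]; rfl
    · refine ⟨?_, ?_, ?_, ?_⟩
      · simp [S, sinSol_zero]
      · simp [S, sinSol_zero, hs]
      · simp [S, sinSol_zero, hs]
      · simp only [ContinuousMap.coe_smul, Pi.smul_apply, S, c, ContinuousMap.coe_mk, sinSol_zero,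
          cosSol_zero, smul_eq_mul, σ]
        split_ifs <;> simp_all
  have h := hC _ _ hmem
  rw [sub_self, norm_zero, mul_zero, norm_le_zero_iff] at h
  have h0 : edgeLp S = 0 := by
    have := hU (0, true)
    rw [h] at this
    simpa [σ] using this.symm
  have hz := eqOn_zero_of_edgeLp_eq_zero h0
  -- If `sinSol` vanished on the edge, so would its derivative at the interior point `1`, against
  -- `cosSol² + k² sinSol² = 1`.
  have hp : (1 : ℝ) ∈ Ioo 0 Real.pi := ⟨one_pos, by linarith [Real.pi_gt_three]⟩
  have hc0 : cosSol k 1 = 0 := by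
    refine (hasDerivAt_sinSol hk 1).unique ((hasDerivAt_const (1 : ℝ) (0 : ℂ)).congr_of_eventuallyEq ?_)
    filter_upwards [Icc_mem_nhds hp.1 hp.2] with y hy using hz y hy
  have h1 := cosSol_sq_add hk 1
  have h2 : sinSol k 1 = 0 := hz 1 (Ioo_subset_Icc_self hp)
  simp [hc0, h2] at h1

/-- A Bloch solution with a unimodular multiplier excludes `k²` from the resolvent set. -/
theorem mem_spectrum_of_multiplier (hk : k ≠ 0) (hs : sinSol k Real.pi ≠ 0) {z : ℂ} (hz : ‖z‖ = 1)
    (hzD : z + z⁻¹ = 2 * chainDiscr α k) : k ^ 2 ∈ unboundedSpectrum (chainHamiltonian α) := by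
  intro hres
  obtain ⟨C, hC0, hC⟩ := exists_bound_of_mem_unboundedResolventSet hres
  have hz0 : z ≠ 0 := by rintro rfl; simp at hz
  set c := cosSol k Real.pi with hc
  set s := sinSol k Real.pi with hsdef
  -- The slope giving `w 0 = 1` and `w π = z`, so that `z ^ j • w` on ring `j` is continuous along
  -- the chain.
  set β : ℂ := (z - c) / s with hβ
  let w : C(ℝ, ℂ) := ⟨fun x => cosSol k x + β * sinSol k x,
    (continuous_cosSol k).add ((continuous_sinSol k).const_mul β)⟩
  let w' : C(ℝ, ℂ) := ⟨fun x => -k ^ 2 * sinSol k x + β * cosSol k x,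
    ((continuous_sinSol k).const_mul _).add ((continuous_cosSol k).const_mul β)⟩
  let co : C(ℝ, ℂ) := ⟨fun x => Complex.cos x, by fun_prop⟩
  let si : C(ℝ, ℂ) := ⟨fun x => Complex.sin x, by fun_prop⟩
  have hco : ∀ x : ℝ, HasDerivAt co (-si x) x := fun x => (Complex.hasDerivAt_cos x).comp_ofReal
  have hsi : ∀ x : ℝ, HasDerivAt si (co x) x := fun x => (Complex.hasDerivAt_sin x).comp_ofReal
  have hw : ∀ x : ℝ, HasDerivAt w (w' x) x := fun x =>
    (hasDerivAt_cosSol hk x).add ((hasDerivAt_sinSol hk x).const_mul β)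
  have hw' : ∀ x : ℝ, HasDerivAt w' (-k ^ 2 * w x) x := fun x =>
    (((hasDerivAt_sinSol hk x).const_mul (-k ^ 2)).add
      ((hasDerivAt_cosSol hk x).const_mul β)).congr_deriv (by
        simp only [w, ContinuousMap.coe_mk]; ring)
  have w0 : w 0 = 1 := by simp [w, cosSol_zero, sinSol_zero]
  have w'0 : w' 0 = β := by simp [w', cosSol_zero, sinSol_zero]
  have wpi : w Real.pi = z := by
    simp only [w, ContinuousMap.coe_mk, hβ, ← hc, ← hsdef]; field_simp; ring
  -- The δ-condition for the Bloch solution, equivalent to `hzD`.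
  have hvertex : 2 * β - 2 * (z⁻¹ * w' Real.pi) = α := by
    have e := cosSol_sq_add hk Real.pi
    simp only [chainDiscr, ← hc, ← hsdef] at hzD e
    simp only [w', ContinuousMap.coe_mk, hβ, ← hc, ← hsdef]
    field_simp at hzD ⊢
    linear_combination hzD / 2 + 2 * e
  -- The commutator term: `-(cos · w)'' - k² cos · w = f`.
  let f : C(ℝ, ℂ) := co * w + (2 : ℂ) • (si * w')
  have hW : 0 < ‖edgeLp w‖ := by
    rw [norm_pos_iff]
    intro h
    have := eqOn_zero_of_edgeLp_eq_zero h 0 (left_mem_Icc.2 Real.pi_pos.le)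
    rw [w0] at this
    exact one_ne_zero this
  have main : ∀ N : ℕ, (N : ℝ) * ‖edgeLp w‖ ^ 2 ≤ C ^ 2 * ‖edgeLp f‖ ^ 2 := by
    intro N
    -- The cutoff is `p + q cos x`: `(1 - cos x) / 2` on ring `0`, `1` on rings `1` to `N`, `(1 +
    -- cos x) / 2` on ring `N + 1`. It is continuous (`hpq`) and flat at every vertex, so the
    -- δ-coupling survives.
    let p : ℤ → ℂ := fun j => if j = 0 ∨ j = N + 1 then 2⁻¹ else if 1 ≤ j ∧ j ≤ N then 1 else 0
    let q : ℤ → ℂ := fun j => if j = 0 then -2⁻¹ else if j = N + 1 then 2⁻¹ else 0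
    have hpq : ∀ j, p j + q j = p (j - 1) - q (j - 1) := by
      intro j
      simp only [p, q]
      split_ifs <;> first | omega | norm_num
    have hp0 : ∀ j, j ∉ Finset.Icc (0 : ℤ) (N + 1) → p j = 0 := by
      intro j hj
      rw [Finset.mem_Icc] at hj
      simp only [p]
      rw [if_neg (by omega), if_neg (by omega)]
    have hq0 : ∀ j, j ∉ ({0, (N : ℤ) + 1} : Finset ℤ) → q j = 0 := by
      intro j hj
      simp only [Finset.mem_insert, Finset.mem_singleton] at hj
      simp only [q]
      rw [if_neg (by omega), if_neg (by omega)]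
    have hq0' : ∀ j, j ∉ Finset.Icc (0 : ℤ) (N + 1) → q j = 0 := by
      intro j hj
      refine hq0 j ?_
      rw [Finset.mem_Icc] at hj
      simp only [Finset.mem_insert, Finset.mem_singleton]
      omega
    let u : ChainEdge → C(ℝ, ℂ) := fun e => z ^ e.1 • (p e.1 • w + q e.1 • (co * w))
    let v : ChainEdge → C(ℝ, ℂ) := fun e =>
      z ^ e.1 • (p e.1 • w' + q e.1 • (co * w' - si * w))
    let U : ChainL2 := ⟨fun e => edgeLp (u e),
      memℓp_of_ring_support (Finset.Icc 0 (N + 1)) fun e he => by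
        simp [u, hp0 _ he, hq0' _ he]⟩
    let F : ChainL2 := ⟨fun e => (z ^ e.1 * q e.1) • edgeLp f,
      memℓp_of_ring_support (Finset.Icc 0 (N + 1)) fun e he => by simp [hq0' _ he]⟩
    have hmem : (U, k ^ 2 • U + F) ∈ chainGraph α := by
      refine mem_chainGraph_of_hasDerivAt U _ u v
        (fun e => k ^ 2 • u e + (z ^ e.1 * q e.1) • f) (fun e x => ?_) (fun e x => ?_)
        (fun e => rfl) (fun e => ?_) fun j => ?_
      · exact ((((hw x).const_mul (p e.1)).add
          (((hco x).mul (hw x)).const_mul (q e.1))).const_mul (z ^ e.1)).congr_deriv (by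
              simp only [v, ContinuousMap.add_apply, ContinuousMap.smul_apply,
                ContinuousMap.mul_apply, ContinuousMap.sub_apply, smul_eq_mul]
              ring)
      · exact ((((hw' x).const_mul (p e.1)).add
          ((((hco x).mul (hw' x)).sub ((hsi x).mul (hw x))).const_mul (q e.1))).const_mul
            (z ^ e.1)).congr_deriv (by
              simp only [u, f, ContinuousMap.add_apply, ContinuousMap.smul_apply,
                ContinuousMap.mul_apply, smul_eq_mul]
              ring)
      · rw [map_add, map_smul, map_smul]; rfl
      · have co0 : co 0 = 1 := by simp [co]
        have copi : co Real.pi = -1 := by simp [co]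
        have si0 : si 0 = 0 := by simp [si]
        have sipi : si Real.pi = 0 := by simp [si]
        have hzj : z ^ (j - 1) = z ^ j * z⁻¹ := zpow_sub_one₀ hz0 j
        have e1 := hpq j
        have e2 : p (j - 1) = p j + q j + q (j - 1) := by linear_combination -e1
        refine ⟨rfl, ?_, ?_, ?_⟩
        · simp [u, w0, wpi, co0, copi, hzj, e2]; field_simp; ring
        · simp [u, w0, wpi, co0, copi, hzj, e2]; field_simp; ring
        · simp only [u, v, ContinuousMap.coe_smul, ContinuousMap.coe_add, ContinuousMap.coe_sub,
            ContinuousMap.coe_mul, Pi.smul_apply, Pi.add_apply, Pi.sub_apply, Pi.mul_apply,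
            smul_eq_mul, w0, w'0, wpi, co0, copi, si0, sipi, hzj, e2]
          linear_combination z ^ j * (p j + q j) * hvertex
    have hUF := hC _ _ hmem
    rw [add_sub_cancel_left] at hUF
    -- Only the four edges of rings `0` and `N + 1` contribute, each a quarter of `‖edgeLp f‖ ^ 2`.
    have hF : ‖F‖ ^ 2 ≤ ‖edgeLp f‖ ^ 2 := by
      rw [lp_two_norm_sq, tsum_eq_sum (s := ({0, (N : ℤ) + 1} : Finset ℤ) ×ˢ Finset.univ)]
      · have hN : (0 : ℤ) ≠ N + 1 := by omega
        have hFe : ∀ e : ChainEdge, ‖F e‖ = ‖q e.1‖ * ‖edgeLp f‖ := fun e => by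
          change ‖(z ^ e.1 * q e.1) • edgeLp f‖ = _
          rw [norm_smul, norm_mul, norm_zpow, hz, one_zpow, one_mul]
        have q1 : ‖q 0‖ = 2⁻¹ := by simp [q]
        have q2 : ‖q (N + 1)‖ = 2⁻¹ := by simp [q, hN.symm]
        simp only [hFe]
        rw [Finset.sum_product, Finset.sum_pair hN]
        simp only [q1, q2, Finset.sum_const, Finset.card_univ, Fintype.card_bool]
        apply le_of_eq
        ring
      · intro e he
        have : e.1 ∉ ({0, (N : ℤ) + 1} : Finset ℤ) := fun h =>
          he (Finset.mem_product.2 ⟨h, Finset.mem_univ _⟩)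
        change ‖(z ^ e.1 * q e.1) • edgeLp f‖ ^ 2 = 0
        simp [hq0 _ this]
    have hUl : (N : ℝ) * ‖edgeLp w‖ ^ 2 ≤ ‖U‖ ^ 2 := by
      have hsub := (lp_two_summable U).sum_le_tsum (Finset.Icc (1 : ℤ) N ×ˢ {true})
        (fun e _ => by positivity)
      rw [← lp_two_norm_sq] at hsub
      refine le_trans (le_of_eq ?_) hsub
      rw [Finset.sum_congr rfl (g := fun _ => ‖edgeLp w‖ ^ 2)]
      · simp
      · rintro ⟨j, b⟩ he
        simp only [Finset.mem_product, Finset.mem_Icc] at he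
        change ‖edgeLp (u (j, b))‖ ^ 2 = _
        have h1 : p j = 1 := by
          simp only [p]; rw [if_neg (by omega), if_pos (by omega)]
        have h2 : q j = 0 := by
          simp only [q]; rw [if_neg (by omega), if_neg (by omega)]
        simp only [u, h1, h2, one_smul, zero_smul, map_add, add_zero, map_smul, norm_smul, norm_zpow, hz,
          one_zpow, one_mul]
    calc (N : ℝ) * ‖edgeLp w‖ ^ 2 ≤ ‖U‖ ^ 2 := hUl
      _ ≤ (C * ‖F‖) ^ 2 := by gcongr
      _ ≤ C ^ 2 * ‖edgeLp f‖ ^ 2 := by rw [mul_pow]; gcongr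
  obtain ⟨N, hN⟩ := exists_nat_gt (C ^ 2 * ‖edgeLp f‖ ^ 2 / ‖edgeLp w‖ ^ 2)
  rw [div_lt_iff₀ (by positivity)] at hN
  exact absurd (main N) (not_le.2 hN)

/-- The conjugate of `k` is `k` or `-k`, and the discriminant is even in `k`. -/
theorem conj_chainDiscr (hk : (k ^ 2).im = 0) :
    (starRingEnd ℂ) (chainDiscr α k) = chainDiscr α k := by
  have h : (starRingEnd ℂ k) ^ 2 = k ^ 2 := by rw [← map_pow]; exact Complex.conj_eq_iff_im.2 hk
  simp only [chainDiscr, cosSol, sinSol, map_add, map_mul, map_div₀, ← Complex.cos_conj,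
    ← Complex.sin_conj, Complex.conj_ofReal, map_ofNat]
  rcases sq_eq_sq_iff_eq_or_eq_neg.1 h with h | h <;> rw [h]
  rw [neg_mul, Complex.cos_neg, Complex.sin_neg, neg_div_neg_eq]

/-- A real `D` in `[-1, 1]` is `cos θ`, and `z = exp (i θ)`. -/
theorem exists_multiplier {D : ℂ} (hD : (starRingEnd ℂ) D = D) (hD1 : ‖D‖ ≤ 1) :
    ∃ z : ℂ, ‖z‖ = 1 ∧ z + z⁻¹ = 2 * D := by
  obtain ⟨d, rfl⟩ := Complex.conj_eq_iff_real.1 hD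
  rw [Complex.norm_real, Real.norm_eq_abs, abs_le] at hD1
  refine ⟨Complex.exp (Real.arccos d * Complex.I), Complex.norm_exp_ofReal_mul_I _, ?_⟩
  rw [← Complex.exp_neg, ← neg_mul, ← Complex.two_cos, ← Complex.ofReal_cos,
    Real.cos_arccos hD1.1 hD1.2]

end

/-- Here `k` is a nonzero number with `k ^ 2` real (so `k` is real or purely imaginary) which is
not a natural number. -/
theorem proposition2p1 (α : ℝ) (k : ℂ) (hk_real : (k ^ 2).im = 0) (hk_ne : k ^ 2 ≠ 0)
    (hk_nat : ∀ n : ℕ, k ≠ n) :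
    k ^ 2 ∈ unboundedSpectrum (chainHamiltonian α) ↔
      ‖Complex.cos (k * Real.pi) + (α / 4 : ℂ) * (Complex.sin (k * Real.pi) / k)‖ ≤ 1 := by
  have hk : k ≠ 0 := fun h => hk_ne (by rw [h]; norm_num)
  change _ ↔ ‖chainDiscr α k‖ ≤ 1
  by_cases hs : sinSol k Real.pi = 0
  · refine iff_of_true (mem_spectrum_of_sinSol_eq_zero hk hs) ?_
    have h := cosSol_sq_add hk Real.pi
    rw [hs] at h
    have hn : ‖cosSol k Real.pi‖ ^ 2 = 1 := by rw [← norm_pow]; simpa using congrArg norm h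
    rw [chainDiscr, hs, mul_zero, add_zero]
    exact (pow_le_one_iff_of_nonneg (norm_nonneg _) two_ne_zero).1 hn.le
  · refine ⟨fun h => ?_, fun h => ?_⟩
    · by_contra hlt
      exact h (mem_resolventSet_of_one_lt_discr hk hs (not_le.1 hlt))
    · obtain ⟨z, hz, hzD⟩ := exists_multiplier (conj_chainDiscr hk_real) h
      exact mem_spectrum_of_multiplier hk hs hz hzD
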